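/- Let $N$ be a factor of type II$_1$ with canonical (faithful normal) tracial state $\tau$, let $G$ be a finite group and let $\alpha$ be an action of $G$ on $N$ by $*$-automorphisms which is outer, i.e. for every $g\neq 1$ the only $a\in N$ with $\alpha_g(x)a=ax$ for all $x\in N$ is $a=0$. Let $M=N\rtimes_\alpha G$ be the von Neumann algebra crossed product, with $N\subset M$, with the canonical unitaries $v_g\in M$ satisfying $v_gxv_g^*=\alpha_g(x)$ $(x\in N)$, and with the trace of $M$, again denoted $\tau$, extending that of $N$ (so that $\tau(\sum_g x_gv_g)=\tau(x_1)$ for $x_g\in N$). Put $\eta(t)=-t\log t$ for $t>0$ and $\eta(0)=0$. For a von Neumann subalgebra $A\subset M$ let $E_A$ be the $\tau$-preserving conditional expectation of $M$ onto $A$, and for von Neumann subalgebras $A,B\subset M$ put $$h(A\mid B)=\sup\sum_i\bigl(\tau\eta(E_B(E_A(x_i)))-\tau\eta(E_A(x_i))\bigr),$$ the supremum being over all finite families $(x_i)$ of positive elements of $M$ with $\sum_ix_i=1$. For a unitary $w\in M$ the entropy of the inner automorphism $\mathrm{Ad}\,w$ of $M$ with respect to $N$ is $H_N(\mathrm{Ad}\,w)=\sum_{g\in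 G}\eta(\tau(w_gw_g^*))$, where $w_g=E_N(wv_g^*)$; it depends only on the automorphism $\mathrm{Ad}\,w$. Then every unitary $u\in M$ has a unique expansion $u=\sum_{g\in G}u_gv_g$ with $u_g\in N$, and $$h(N\mid uNu^*)\ \le\ H_N(\mathrm{Ad}\,u)\ =\ \sum_{g\in G}\eta(\tau(u_gu_g^*))\ \le\ \log|G|.$$ -/

import Mathlib

open scoped InnerProductSpace ComplexOrder

noncomputable section

set_option linter.unusedSectionVars false

/-! ### Von Neumann algebras as C⋆-algebras, factors of type II₁, outer actions -/

namespace VonNeumannAlgebra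

variable {H : Type*} [NormedAddCommGroup H] [InnerProductSpace ℂ H] [CompleteSpace H]

/-- The elements of a von Neumann algebra. -/
abbrev Elem (N : VonNeumannAlgebra H) : Type _ := ↥N.toStarSubalgebra

/-- The elements of a von Neumann algebra form a norm-closed set, hence, with the operations and
the norm of `B(H)`, a C⋆-algebra. -/
instance isClosed_toStarSubalgebra (N : VonNeumannAlgebra H) :
    IsClosed (N.toStarSubalgebra : Set (H →L[ℂ] H)) := by
  rw [coe_toStarSubalgebra, ← centralizer_centralizer N]
  exact Set.isClosed_centralizer _

/-- The von Neumann algebra generated by a set `S` of bounded operators: the double commutant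
of `S ∪ S⋆`. -/
def generatedBy (S : Set (H →L[ℂ] H)) : VonNeumannAlgebra H where
  toStarSubalgebra :=
    StarSubalgebra.centralizer ℂ (StarSubalgebra.centralizer ℂ S : Set (H →L[ℂ] H))
  centralizer_centralizer' := by
    exact Set.centralizer_centralizer_centralizer _

theorem subset_generatedBy (S : Set (H →L[ℂ] H)) :
    S ⊆ ((generatedBy S).toStarSubalgebra : Set (H →L[ℂ] H)) := by
  intro x hx
  change x ∈ StarSubalgebra.centralizer ℂ (StarSubalgebra.centralizer ℂ S : Set (H →L[ℂ] H))
  rw [StarSubalgebra.mem_centralizer_iff]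
  intro g hg
  have h1 := (StarSubalgebra.mem_centralizer_iff ℂ).1 hg x hx
  have h2 := (StarSubalgebra.mem_centralizer_iff ℂ).1 (star_mem hg) x hx
  exact ⟨h1.1.symm, h2.1.symm⟩

/-- `τ` is a faithful normal tracial state on the von Neumann algebra `N`. Normality is
σ-weak continuity: `τ` has the form `x ↦ ∑ₙ ⟪ηₙ, x ξₙ⟫` for square-summable sequences of vectors. -/
structure IsFaithfulNormalTracialState (N : VonNeumannAlgebra H) (τ : N.Elem →ₗ[ℂ] ℂ) :
    Prop where
  nonneg : ∀ x : N.Elem, 0 ≤ τ (star x * x)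
  map_one : τ 1 = 1
  trace : ∀ x y : N.Elem, τ (x * y) = τ (y * x)
  faithful : ∀ x : N.Elem, τ (star x * x) = 0 → x = 0
  normal : ∃ ξ η : ℕ → H, Summable (fun n => ‖ξ n‖ ^ 2) ∧ Summable (fun n => ‖η n‖ ^ 2) ∧
    ∀ x : N.Elem, HasSum (fun n => ⟪η n, (x : H →L[ℂ] H) (ξ n)⟫_ℂ) (τ x)

/-- `N` is a factor of type II₁: its centre consists of the scalars, it is infinite-dimensional,
and it has a faithful normal tracial state. -/
structure IsII1Factor (N : VonNeumannAlgebra H) : Prop where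
  factor : ∀ z : N.Elem, (∀ x : N.Elem, z * x = x * z) → ∃ c : ℂ, z = c • (1 : N.Elem)
  infinite_dimensional : ¬ FiniteDimensional ℂ N.Elem
  exists_trace : ∃ τ : N.Elem →ₗ[ℂ] ℂ, N.IsFaithfulNormalTracialState τ

/-- An action `α` of a group on `N` is outer: for `g ≠ 1`, the only `a ∈ N` with
`α_g(x) a = a x` for all `x ∈ N` is `a = 0`. -/
def IsOuterAction {G : Type*} [Group G] (N : VonNeumannAlgebra H)
    (α : G →* (N.Elem ≃⋆ₐ[ℂ] N.Elem)) : Prop :=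
  ∀ g : G, g ≠ 1 → ∀ a : N.Elem, (∀ x : N.Elem, α g x * a = a * x) → a = 0

/-! ### The crossed product by a finite group -/

variable {G : Type*} [Group G] [Fintype G]

/-- The representation `π` of `N` on `ℓ²(G, H)`: `(π(x) ξ)(s) = α_{s⁻¹}(x) ξ(s)`. -/
def crossedRep (N : VonNeumannAlgebra H) (α : G →* (N.Elem ≃⋆ₐ[ℂ] N.Elem)) (x : N.Elem) :
    PiLp 2 (fun _ : G => H) →L[ℂ] PiLp 2 (fun _ : G => H) :=
  (PiLp.continuousLinearEquiv 2 ℂ (fun _ : G => H)).symm.toContinuousLinearMap ∘L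
    ContinuousLinearMap.pi fun s : G =>
      ((α s⁻¹ x : N.Elem) : H →L[ℂ] H) ∘L PiLp.proj 2 (fun _ : G => H) s

/-- The left translation `λ_g` on `ℓ²(G, H)`: `(λ_g ξ)(s) = ξ(g⁻¹ s)`. -/
def crossedShift (H : Type*) [NormedAddCommGroup H] [InnerProductSpace ℂ H] (g : G) :
    PiLp 2 (fun _ : G => H) →L[ℂ] PiLp 2 (fun _ : G => H) :=
  (PiLp.continuousLinearEquiv 2 ℂ (fun _ : G => H)).symm.toContinuousLinearMap ∘L
    ContinuousLinearMap.pi fun s : G => PiLp.proj 2 (fun _ : G => H) (g⁻¹ * s)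

@[simp]
theorem crossedRep_apply (N : VonNeumannAlgebra H) (α : G →* (N.Elem ≃⋆ₐ[ℂ] N.Elem))
    (x : N.Elem) (ξ : PiLp 2 (fun _ : G => H)) (s : G) :
    crossedRep N α x ξ s = ((α s⁻¹ x : N.Elem) : H →L[ℂ] H) (ξ s) := rfl

@[simp]
theorem crossedShift_apply (g : G) (ξ : PiLp 2 (fun _ : G => H)) (s : G) :
    crossedShift H g ξ s = ξ (g⁻¹ * s) := rfl

/-- The crossed product `N ⋊_α G`: the von Neumann algebra on `ℓ²(G, H)` generated by `π(N)`
and the translations `λ_g`. -/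
def crossedProduct (N : VonNeumannAlgebra H) (α : G →* (N.Elem ≃⋆ₐ[ℂ] N.Elem)) :
    VonNeumannAlgebra (PiLp 2 (fun _ : G => H)) :=
  generatedBy (Set.range (crossedRep N α) ∪ Set.range (crossedShift (G := G) H))

theorem crossedRep_star (N : VonNeumannAlgebra H) (α : G →* (N.Elem ≃⋆ₐ[ℂ] N.Elem))
    (x : N.Elem) : crossedRep N α (star x) = star (crossedRep N α x) := by
  rw [ContinuousLinearMap.star_eq_adjoint, ContinuousLinearMap.eq_adjoint_iff]
  intro ξ ζ
  simp only [PiLp.inner_apply, crossedRep_apply, map_star]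
  refine Finset.sum_congr rfl fun s _ => ?_
  exact ContinuousLinearMap.adjoint_inner_left _ _ _

theorem crossedShift_star (g : G) :
    star (crossedShift H g) = crossedShift H g⁻¹ := by
  symm
  rw [ContinuousLinearMap.star_eq_adjoint, ContinuousLinearMap.eq_adjoint_iff]
  intro ξ ζ
  simp only [PiLp.inner_apply, crossedShift_apply, inv_inv]
  exact Fintype.sum_equiv (Equiv.mulLeft g) _ _ (fun s => by simp)

theorem crossedShift_mul (g h : G) :
    crossedShift H g * crossedShift H h = crossedShift H (g * h) := by
  ext ξ s
  simp [mul_assoc]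

theorem crossedShift_one : crossedShift H (1 : G) = 1 := by
  ext ξ s
  simp

/-- The embedding `π : N → N ⋊_α G`, as a ⋆-homomorphism. -/
def crossedEmbedding (N : VonNeumannAlgebra H) (α : G →* (N.Elem ≃⋆ₐ[ℂ] N.Elem)) :
    N.Elem →⋆ₐ[ℂ] (crossedProduct N α).Elem where
  toFun x := ⟨crossedRep N α x, subset_generatedBy _ (Or.inl ⟨x, rfl⟩)⟩
  map_one' := by
    apply Subtype.ext
    ext ξ s
    simp
  map_mul' x y := by
    apply Subtype.ext
    ext ξ s
    simp
  map_zero' := by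
    apply Subtype.ext
    ext ξ s
    simp
  map_add' x y := by
    apply Subtype.ext
    ext ξ s
    simp
  commutes' c := by
    apply Subtype.ext
    ext ξ s
    simp [Algebra.algebraMap_eq_smul_one]
  map_star' x := Subtype.ext (crossedRep_star N α x)

/-- The unitary representation `v` of `G` in `N ⋊_α G`, given by the translations. -/
def crossedUnitary (N : VonNeumannAlgebra H) (α : G →* (N.Elem ≃⋆ₐ[ℂ] N.Elem)) :
    G →* unitary (crossedProduct N α).Elem where
  toFun g := ⟨⟨crossedShift H g, subset_generatedBy _ (Or.inr ⟨g, rfl⟩)⟩, by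
    rw [Unitary.mem_iff]
    constructor <;> apply Subtype.ext
    · change star (crossedShift H g) * crossedShift H g = 1
      rw [crossedShift_star, crossedShift_mul, inv_mul_cancel, crossedShift_one]
    · change crossedShift H g * star (crossedShift H g) = 1
      rw [crossedShift_star, crossedShift_mul, mul_inv_cancel, crossedShift_one]⟩
  map_one' := Subtype.ext (Subtype.ext crossedShift_one)
  map_mul' g h := Subtype.ext (Subtype.ext (crossedShift_mul g h).symm)

/-- The copy of `N` inside `N ⋊_α G`. -/
def crossedSubalgebra (N : VonNeumannAlgebra H) (α : G →* (N.Elem ≃⋆ₐ[ℂ] N.Elem)) :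
    StarSubalgebra ℂ (crossedProduct N α).Elem :=
  (crossedEmbedding N α).range

/-- The diagonal coefficient `T ↦ T(1,1)` at the identity of `G` of an operator on `ℓ²(G, H)`. -/
def unitEntry (T : PiLp 2 (fun _ : G => H) →L[ℂ] PiLp 2 (fun _ : G => H)) : H →L[ℂ] H :=
  PiLp.proj 2 (fun _ : G => H) 1 ∘L T ∘L
    ContinuousLinearMap.adjoint (PiLp.proj 2 (fun _ : G => H) (1 : G))

/-- The operator `y ⊗ 1` on `ℓ²(G, H)`, acting as `y` in each coordinate. -/
def diagonalOp (G : Type*) [Fintype G] (y : H →L[ℂ] H) :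
    PiLp 2 (fun _ : G => H) →L[ℂ] PiLp 2 (fun _ : G => H) :=
  (PiLp.continuousLinearEquiv 2 ℂ (fun _ : G => H)).symm.toContinuousLinearMap ∘L
    ContinuousLinearMap.pi fun s : G => y ∘L PiLp.proj 2 (fun _ : G => H) s

@[simp]
theorem diagonalOp_apply (y : H →L[ℂ] H) (ξ : PiLp 2 (fun _ : G => H)) (s : G) :
    diagonalOp G y ξ s = y (ξ s) := rfl

theorem diagonalOp_star (y : H →L[ℂ] H) : diagonalOp G (star y) = star (diagonalOp G y) := by
  rw [ContinuousLinearMap.star_eq_adjoint, ContinuousLinearMap.star_eq_adjoint,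
    ContinuousLinearMap.eq_adjoint_iff]
  intro ξ ζ
  simp only [PiLp.inner_apply, diagonalOp_apply]
  exact Finset.sum_congr rfl fun s _ => ContinuousLinearMap.adjoint_inner_left _ _ _

theorem commute_diagonalOp (N : VonNeumannAlgebra H) (α : G →* (N.Elem ≃⋆ₐ[ℂ] N.Elem))
    (y : H →L[ℂ] H) (hy : y ∈ N.commutant) (T : (crossedProduct N α).Elem) :
    diagonalOp G y * (T : PiLp 2 (fun _ : G => H) →L[ℂ] PiLp 2 (fun _ : G => H)) =
      T * diagonalOp G y := by
  have key : ∀ z ∈ N.commutant, ∀ S ∈ Set.range (crossedRep N α) ∪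
      Set.range (crossedShift (G := G) H), S * diagonalOp G z = diagonalOp G z * S := by
    rintro z hz S (⟨x, rfl⟩ | ⟨g, rfl⟩)
    · ext ξ s
      exact DFunLike.congr_fun (mem_commutant_iff.1 hz _ (α s⁻¹ x : N.Elem).2) (ξ s)
    · rfl
  have hmem : diagonalOp G y ∈ StarSubalgebra.centralizer ℂ
      (Set.range (crossedRep N α) ∪ Set.range (crossedShift (G := G) H)) := by
    rw [StarSubalgebra.mem_centralizer_iff]
    intro S hS
    refine ⟨key y hy S hS, ?_⟩
    have h := congrArg star (key (star y) (star_mem hy) S hS)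
    rw [diagonalOp_star] at h
    simpa using h.symm
  exact ((StarSubalgebra.mem_centralizer_iff ℂ).1 T.2 _ hmem).1

theorem commute_compression {K : Type*} [NormedAddCommGroup K] [InnerProductSpace ℂ K]
    (P : K →L[ℂ] H) (J : H →L[ℂ] K) (D T : K →L[ℂ] K) (y : H →L[ℂ] H)
    (h1 : y ∘L P = P ∘L D) (h2 : J ∘L y = D ∘L J) (h3 : D * T = T * D) :
    y * (P ∘L T ∘L J) = (P ∘L T ∘L J) * y := by
  ext ξ
  have e1 := DFunLike.congr_fun h1 (T (J ξ))
  have e2 := DFunLike.congr_fun h2 ξ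
  have e3 := DFunLike.congr_fun h3 (J ξ)
  simp only [ContinuousLinearMap.comp_apply, mul_apply_eq_comp] at e1 e2 e3 ⊢
  rw [e1, e2, e3]

theorem unitEntry_mem (N : VonNeumannAlgebra H) (α : G →* (N.Elem ≃⋆ₐ[ℂ] N.Elem))
    (T : (crossedProduct N α).Elem) :
    unitEntry (T : PiLp 2 (fun _ : G => H) →L[ℂ] PiLp 2 (fun _ : G => H)) ∈
      N.toStarSubalgebra := by
  suffices h : unitEntry (T : PiLp 2 (fun _ : G => H) →L[ℂ] PiLp 2 (fun _ : G => H)) ∈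
      N.commutant.commutant by
    have e : N.commutant.commutant = N := commutant_commutant N
    exact (SetLike.ext_iff.1 e _).1 h
  rw [mem_commutant_iff]
  intro y hy
  have h (z : H →L[ℂ] H) : z ∘L PiLp.proj (𝕜 := ℂ) 2 (fun _ : G => H) (1 : G) =
      PiLp.proj (𝕜 := ℂ) 2 (fun _ : G => H) (1 : G) ∘L diagonalOp G z := rfl
  refine commute_compression _ _ (diagonalOp G y) _ y (h y) ?_ (commute_diagonalOp N α y hy T)
  have h' := congrArg ContinuousLinearMap.adjoint (h (star y))
  rw [ContinuousLinearMap.adjoint_comp, ContinuousLinearMap.adjoint_comp, diagonalOp_star,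
    ContinuousLinearMap.star_eq_adjoint, ContinuousLinearMap.star_eq_adjoint,
    ContinuousLinearMap.adjoint_adjoint, ContinuousLinearMap.adjoint_adjoint] at h'
  exact h'

/-- The canonical extension to `N ⋊_α G` of a trace `τ` of `N`: `∑ x_g v_g ↦ τ(x_1)`, where
`x_1 ∈ N` is the diagonal coefficient at the identity. -/
def crossedTrace (N : VonNeumannAlgebra H) (α : G →* (N.Elem ≃⋆ₐ[ℂ] N.Elem))
    (τ : N.Elem →ₗ[ℂ] ℂ) : (crossedProduct N α).Elem →ₗ[ℂ] ℂ where
  toFun T := τ ⟨unitEntry (T : PiLp 2 (fun _ : G => H) →L[ℂ] PiLp 2 (fun _ : G => H)),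
    unitEntry_mem N α T⟩
  map_add' S T := by
    rw [← map_add]
    exact congrArg τ (Subtype.ext (by ext ξ; simp [unitEntry]))
  map_smul' c T := by
    rw [RingHom.id_apply, ← map_smul]
    exact congrArg τ (Subtype.ext (by ext ξ; simp [unitEntry]))

end VonNeumannAlgebra

/-! ### Conditional expectations and the conditional relative entropy -/

section Entropy

variable {M : Type*} [CStarAlgebra M]

open scoped Classical in
/-- The trace-preserving conditional expectation `E_A : M → A` of a finite von Neumann algebra
with faithful normal tracial state `τ` onto a von Neumann subalgebra `A`: `E_A(x)` is the unique
`y ∈ A` with `τ(y a) = τ(x a)` for all `a ∈ A`. -/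
def condExpectation (τ : M →ₗ[ℂ] ℂ) (A : StarSubalgebra ℂ M) (x : M) : M :=
  if h : ∃ y ∈ A, ∀ a ∈ A, τ (y * a) = τ (x * a) then h.choose else 0

/-- `τ η (x)`, for `η(t) = -t log t` applied to `x` by functional calculus. -/
def traceEta (τ : M →ₗ[ℂ] ℂ) (x : M) : ℝ := (τ (cfc Real.negMulLog x)).re

/-- The conditional relative entropy
`h(A | B) = sup ∑ᵢ (τ η E_B(E_A(xᵢ)) - τ η E_A(xᵢ))`, the supremum being over the finite families
of positive elements of `M` with sum `1`. -/
def condRelEntropy (τ : M →ₗ[ℂ] ℂ) (A B : StarSubalgebra ℂ M) : EReal :=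
  ⨆ (n : ℕ) (x : Fin n → M) (_ : ∀ i, ∃ y : M, x i = star y * y) (_ : ∑ i, x i = 1),
    ((∑ i, (traceEta τ (condExpectation τ B (condExpectation τ A (x i))) -
      traceEta τ (condExpectation τ A (x i))) : ℝ) : EReal)

end Entropy

namespace VonNeumannAlgebra

variable {H : Type*} [NormedAddCommGroup H] [InnerProductSpace ℂ H] [CompleteSpace H]
  {G : Type*} [Group G] [Fintype G]

open scoped Classical in
/-- The entropy `H_N(θ) = ∑_g η(τ(w_g w_g⋆))` of an inner automorphism `θ = Ad w` of
`M = N ⋊_α G` with respect to `N`, where `w_g = E_N(w v_g⋆)`; the value does not depend on the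
choice of the unitary `w`. -/
def innerAutEntropy (N : VonNeumannAlgebra H) (α : G →* (N.Elem ≃⋆ₐ[ℂ] N.Elem))
    (τ : N.Elem →ₗ[ℂ] ℂ)
    (θ : (crossedProduct N α).Elem ≃⋆ₐ[ℂ] (crossedProduct N α).Elem) : ℝ :=
  if h : ∃ w : unitary (crossedProduct N α).Elem, θ = Unitary.conjStarAlgAut ℂ _ w then
    ∑ g : G, Real.negMulLog (crossedTrace N α τ
      (condExpectation (crossedTrace N α τ) (crossedSubalgebra N α)
          ((h.choose : (crossedProduct N α).Elem) * star (crossedUnitary N α g : (crossedProduct N α).Elem)) *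
        star (condExpectation (crossedTrace N α τ) (crossedSubalgebra N α)
          ((h.choose : (crossedProduct N α).Elem) * star (crossedUnitary N α g : (crossedProduct N α).Elem))))).re
  else 0

end VonNeumannAlgebra

end

/-!
Write `τ` for the trace, `E` for the expectation of `M = N ⋊ G` onto `N`, `η(t) = -t log t` and
`S(x) = τ η(x)`.

**Structure of the crossed product.** Since `M` is defined as a bicommutant on `ℓ²(G, H)`, with no
implementation of `α` on `H` available, two facts have to be established first.

* `τ ∘ α_g = τ` (`IsFaithfulTracialState.map_automorphism`). Minimizing the `2`-norm over a convex
  set stable under unitary conjugation produces, `N` being a factor, elements that are arbitrarily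
  small in the `2`-norm and on which `τ` and `τ ∘ α_g` take the same values as on a given element
  of trace `0`. As an order isomorphism, `α_g` is absolutely continuous for `τ`
  (`IsFaithfulTracialState.not_forall_le_map`), so that `τ ∘ α_g` has to vanish on that element
  too. Normality enters through weak compactness of balls (`HasWeakUltralimits`).
* Every element of `M` is a finite sum `∑ x_g v_g` (`VonNeumannAlgebra.eq_sum_crossedExpectation`).
  This reduces to the equivariance `E(v_g T v_g⋆) = α_g(E(T))`, an equality of normal functionals
  of `T` after pairing with `τ(w ·)`; it holds on the finite sums, hence on their bicommutant
  (`tsum_inner_eq_zero_of_mem_bicommutant`).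

From there on only the relations recorded in `IsCrossedSystem` matter: `τ ∘ E` is a faithful trace,
`E_N = E`, `E_{uNu⋆}(x) = u E(u⋆ x u) u⋆`, and `M` is a factor because `α` is outer, so that `Ad u`
determines `u` up to a scalar of modulus `1`.

**The entropy estimate.** Let `xᵢ` be a partition of unity and `aᵢ = E(xᵢ)`. For `u = ∑ u_g v_g`,
`E(u⋆ aᵢ u) = ∑ α_g⁻¹(u_g⋆ aᵢ u_g)`. As `log` is operator monotone, `S` is subadditive, so the
entropy of this element is at most `∑ S(u_g⋆ aᵢ u_g) = ∑ S(b_{ig})` with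
`b_{ig} = aᵢ^{1/2} u_g u_g⋆ aᵢ^{1/2}`, where `∑_g b_{ig} = aᵢ`. Klein's inequality
(`IsFaithfulTracialState.klein`) for the pair `b_{ig}`, `l_g aᵢ` with `l_g = τ(u_g u_g⋆)` reads
`S(b_{ig}) + τ(b_{ig} log aᵢ) + (log l_g + 1) τ(b_{ig}) ≤ l_g τ(aᵢ)`. Summing over `i` and `g`
leaves exactly `∑ S(b_{ig}) - ∑ S(aᵢ) ≤ ∑ η(l_g)`
(`IsFaithfulTracialState.sum_traceEta_conj_sub_le`). The last bound by `log |G|` is the concavity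
of `η`.
-/

/-! ### Faithful tracial states on a C⋆-algebra -/

/-- `τ` is a faithful tracial state on the C⋆-algebra `A`; no normality is demanded. -/
structure IsFaithfulTracialState {A : Type*} [CStarAlgebra A] (τ : A →ₗ[ℂ] ℂ) : Prop where
  nonneg : ∀ x : A, 0 ≤ τ (star x * x)
  map_one : τ 1 = 1
  trace : ∀ x y : A, τ (x * y) = τ (y * x)
  faithful : ∀ x : A, τ (star x * x) = 0 → x = 0

namespace IsFaithfulTracialState

variable {A : Type*} [CStarAlgebra A] {τ : A →ₗ[ℂ] ℂ}

theorem re_smul (τ : A →ₗ[ℂ] ℂ) (r : ℝ) (a : A) : (τ (r • a)).re = r * (τ a).re := by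
  rw [LinearMap.map_smul_of_tower, Complex.real_smul, Complex.re_ofReal_mul]

theorem re_one (hτ : IsFaithfulTracialState τ) : (τ 1).re = 1 := by
  rw [hτ.map_one, Complex.one_re]

theorem re_star_mul_self (hτ : IsFaithfulTracialState τ) (x : A) : 0 ≤ (τ (star x * x)).re :=
  (Complex.nonneg_iff.1 (hτ.nonneg x)).1

theorem eq_zero_of_re (hτ : IsFaithfulTracialState τ) {x : A}
    (h : (τ (star x * x)).re = 0) : x = 0 :=
  hτ.faithful x (Complex.ext h (Complex.nonneg_iff.1 (hτ.nonneg x)).2.symm)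

theorem eq_of_forall_mul (hτ : IsFaithfulTracialState τ) {x y : A}
    (h : ∀ w, τ (w * x) = τ (w * y)) : x = y := by
  have := hτ.faithful (x - y) (by rw [mul_sub, map_sub, h, sub_self])
  exact sub_eq_zero.1 this

theorem aeval_star_mul_self (hτ : IsFaithfulTracialState τ) (x : A) (p : Polynomial ℝ) :
    τ (Polynomial.aeval (star x * x) p) = τ (Polynomial.aeval (x * star x) p) := by
  induction p using Polynomial.induction_on' with
  | add p q hp hq => rw [map_add, map_add, map_add, map_add, hp, hq]
  | monomial n r =>
    rw [Polynomial.aeval_monomial, Polynomial.aeval_monomial, ← Algebra.smul_def,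
      ← Algebra.smul_def, LinearMap.map_smul_of_tower, LinearMap.map_smul_of_tower]
    congr 1
    cases n with
    | zero => rw [pow_zero, pow_zero]
    | succ n => rw [pow_succ', mul_assoc, hτ.trace, mul_assoc, mul_pow_mul, ← mul_assoc,
        ← pow_succ']

section Order

variable [PartialOrder A] [StarOrderedRing A]

theorem map_nonneg (hτ : IsFaithfulTracialState τ) {a : A} (ha : 0 ≤ a) : 0 ≤ τ a := by
  obtain ⟨b, rfl⟩ := CStarAlgebra.nonneg_iff_eq_star_mul_self.1 ha
  exact hτ.nonneg b

theorem re_nonneg (hτ : IsFaithfulTracialState τ) {a : A} (ha : 0 ≤ a) : 0 ≤ (τ a).re :=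
  (Complex.nonneg_iff.1 (hτ.map_nonneg ha)).1

theorem re_mono (hτ : IsFaithfulTracialState τ) {a b : A} (h : a ≤ b) :
    (τ a).re ≤ (τ b).re := by
  have := hτ.re_nonneg (sub_nonneg.2 h)
  rw [map_sub, Complex.sub_re] at this
  linarith

/-- A tracial state takes a nonnegative real part on a product of two positive elements. -/
theorem re_mul_nonneg (hτ : IsFaithfulTracialState τ) {a b : A} (ha : 0 ≤ a) (hb : 0 ≤ b) :
    0 ≤ (τ (a * b)).re := by
  obtain ⟨s, rfl⟩ := CStarAlgebra.nonneg_iff_eq_star_mul_self.1 hb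
  rw [← mul_assoc, hτ.trace, ← mul_assoc]
  exact hτ.re_nonneg (star_right_conjugate_nonneg ha s)

theorem re_mul_le_mul (hτ : IsFaithfulTracialState τ) {a b c : A} (ha : 0 ≤ a) (h : b ≤ c) :
    (τ (a * b)).re ≤ (τ (a * c)).re := by
  have := hτ.re_mul_nonneg ha (sub_nonneg.2 h)
  rw [mul_sub, map_sub, Complex.sub_re] at this
  linarith

theorem apply_star (hτ : IsFaithfulTracialState τ) (a : A) : τ (star a) = star (τ a) :=
  StarHomClass.map_star (PositiveLinearMap.mk₀ τ fun _ h => hτ.map_nonneg h) a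

theorem re_mul_le_norm (hτ : IsFaithfulTracialState τ) {a d : A} (ha : 0 ≤ a)
    (hd : IsSelfAdjoint d) {δ : ℝ} (h : ‖d‖ ≤ δ) : (τ (a * d)).re ≤ δ * (τ a).re := by
  have h1 : d ≤ δ • (1 : A) :=
    (IsSelfAdjoint.le_algebraMap_norm_self hd).trans (by
      rw [Algebra.algebraMap_eq_smul_one]
      exact smul_le_smul_of_nonneg_right h zero_le_one)
  have := hτ.re_mul_le_mul ha h1
  rwa [mul_smul_comm, re_smul, mul_one] at this

end Order

end IsFaithfulTracialState

/-! ### Trace inequalities for the entropy function -/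

section Spectrum

variable {A : Type*} [CStarAlgebra A] [PartialOrder A] [StarOrderedRing A]

theorem spectrum_subset_Icc_zero_one {c : A} (hc : 0 ≤ c) (hc1 : c ≤ 1) :
    spectrum ℝ c ⊆ Set.Icc 0 1 := by
  intro t ht
  refine ⟨spectrum_nonneg_of_nonneg hc ht, ?_⟩
  have := (le_algebraMap_iff_spectrum_le (r := (1 : ℝ)) (a := c)).1 (by simpa using hc1) t ht
  exact this

/-- Bernstein polynomials, evaluated at a positive contraction `c`, give finite partitions of
unity `Φ` such that `g(c)` and `c` are uniformly close to `∑ g(yₖ) Φₖ` and `∑ yₖ Φₖ`. -/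
theorem exists_partition_approx {c : A} (hc : 0 ≤ c) (hc1 : c ≤ 1) {g : ℝ → ℝ}
    (hg : ContinuousOn g (Set.Icc 0 1)) {δ : ℝ} (hδ : 0 < δ) :
    ∃ (n : ℕ) (Φ : Fin n → A) (y : Fin n → ℝ), (∀ k, 0 ≤ Φ k) ∧ (∀ k, y k ∈ Set.Icc (0 : ℝ) 1) ∧
      ∑ k, Φ k = 1 ∧ ‖cfc g c - ∑ k, g (y k) • Φ k‖ ≤ δ ∧ ‖c - ∑ k, y k • Φ k‖ ≤ δ := by
  have hspec := spectrum_subset_Icc_zero_one hc hc1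
  -- uniform approximation on `[0,1]` of `g` and of the identity by the same Bernstein nodes
  let G : C(unitInterval, ℝ) := ⟨fun t => g t, continuousOn_iff_continuous_domRestrict.1 hg⟩
  let I : C(unitInterval, ℝ) := ⟨fun t => t, continuous_subtype_val⟩
  have e1 := Metric.tendsto_nhds.1 (bernsteinApproximation_uniform G) δ hδ
  have e2 := Metric.tendsto_nhds.1 (bernsteinApproximation_uniform I) δ hδ
  obtain ⟨n, h1, h2⟩ := (e1.and e2).exists
  let φ : Fin (n + 1) → ℝ → ℝ := fun k t => (n.choose k : ℝ) * t ^ (k : ℕ) * (1 - t) ^ (n - k)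
  have hφ : ∀ k, Continuous (φ k) := fun k => by fun_prop
  have hb : ∀ (k : Fin (n + 1)) (t : unitInterval), bernstein n k t = φ k t :=
    fun k t => bernstein_apply n k t
  have sum_cfc : ∀ r : Fin (n + 1) → ℝ,
      ∑ k, r k • cfc (φ k) c = cfc (fun t => ∑ k, r k * φ k t) c := by
    intro r
    have : (fun t => ∑ k, r k * φ k t) = ∑ k, (fun t => r k * φ k t) := by
      ext t; simp
    rw [this, cfc_sum _ _ _ (fun k _ => ((hφ k).const_mul (r k)).continuousOn)]
    exact Finset.sum_congr rfl fun k _ => (cfc_const_mul (r k) (φ k) c (hφ k).continuousOn).symm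
  have hc' : IsSelfAdjoint c := .of_nonneg hc
  have approx : ∀ (f : ℝ → ℝ) (F : C(unitInterval, ℝ)), ContinuousOn f (Set.Icc 0 1) →
      (∀ t : unitInterval, F t = f t) → dist (bernsteinApproximation n F) F < δ →
      ‖cfc f c - ∑ k : Fin (n + 1), f (bernstein.z k : unitInterval) • cfc (φ k) c‖ ≤ δ := by
    intro f F hf hF hd
    have hcont : Continuous fun t => ∑ k : Fin (n + 1), f (bernstein.z k : unitInterval) * φ k t :=
      continuous_finsetSum _ fun k _ => (hφ k).const_mul _
    rw [sum_cfc, ← cfc_sub f _ c (hf.mono hspec) hcont.continuousOn]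
    refine norm_cfc_le hδ.le fun t ht => ?_
    have := (ContinuousMap.dist_apply_le_dist (f := bernsteinApproximation n F) (g := F)
      ⟨t, hspec ht⟩).trans hd.le
    rw [bernsteinApproximation.apply, dist_comm, Real.dist_eq, hF] at this
    have e : ∑ k : Fin (n + 1), f (bernstein.z k : unitInterval) * φ k t =
        ∑ k : Fin (n + 1), bernstein n k ⟨t, hspec ht⟩ • F (bernstein.z k) :=
      Finset.sum_congr rfl fun k _ => by rw [hb, hF, smul_eq_mul, mul_comm]
    rw [Real.norm_eq_abs, e]
    exact this
  refine ⟨n + 1, fun k => cfc (φ k) c, fun k => (bernstein.z k : unitInterval),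
    fun k => ?_, fun k => (bernstein.z k).2, ?_, approx g G hg (fun _ => rfl) h1, ?_⟩
  · refine cfc_nonneg fun t ht => ?_
    rw [← hb k ⟨t, hspec ht⟩]
    exact bernstein_nonneg
  · have h3 := sum_cfc (fun _ => 1)
    simp only [one_smul, one_mul] at h3
    rw [h3]
    refine (cfc_congr (g := fun _ => 1) fun t ht => ?_).trans (cfc_const_one ℝ c)
    have := bernstein.probability n ⟨t, hspec ht⟩
    simpa only [hb] using this
  · have := approx id I continuousOn_id (fun _ => rfl) h2
    rwa [cfc_id ℝ c] at this

end Spectrum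

theorem mul_log_add_le_neg_negMulLog {x y l : ℝ} (hx : 0 ≤ x) (hy : 0 < y) (hl : 0 < l) :
    Real.negMulLog x + (Real.log y + (Real.log l + 1)) * x - l * y ≤ 0 := by
  rcases hx.eq_or_lt with rfl | hx
  · simp; positivity
  · have h := Real.log_le_sub_one_of_pos (show 0 < l * y / x by positivity)
    rw [Real.log_div (by positivity) hx.ne', Real.log_mul hl.ne' hy.ne'] at h
    have h2 : x * (Real.log l + Real.log y - Real.log x) ≤ x * (l * y / x - 1) :=
      mul_le_mul_of_nonneg_left h hx.le
    have h3 : x * (l * y / x - 1) = l * y - x := by field_simp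
    rw [Real.negMulLog]
    linarith

theorem continuousOn_log_add {ε : ℝ} (hε : 0 < ε) :
    ContinuousOn (fun y => Real.log (y + ε)) (Set.Ici 0) := fun y hy =>
  ((continuous_id.add_const ε).continuousAt.log
    (by have : (0 : ℝ) ≤ y := hy; simp; positivity)).continuousWithinAt

namespace IsFaithfulTracialState

variable {A : Type*} [CStarAlgebra A] {τ : A →ₗ[ℂ] ℂ}

section Order

variable [PartialOrder A] [StarOrderedRing A]

theorem spectrum_subset_Ici {a : A} (ha : 0 ≤ a) : spectrum ℝ a ⊆ Set.Ici 0 :=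
  fun _ ht => spectrum_nonneg_of_nonneg ha ht

/-- A form of Klein's inequality: the scalar inequality
`-x log x + x log (l y) + x - l y ≤ 0` persists under the trace with `x` and `y` replaced by
positive elements that need not commute. The positive functional `f ⊗ g ↦ τ (f(b) g(c))` is
tested against a partition of unity in the second variable. The shift by `ε` keeps the logarithm
continuous on the spectrum of `c`. -/
theorem klein (hτ : IsFaithfulTracialState τ) {b c : A} (hb : 0 ≤ b) (hc : 0 ≤ c) (hc1 : c ≤ 1)
    {ε l : ℝ} (hε : 0 < ε) (hl : 0 < l) :
    traceEta τ b + (τ (b * cfc (fun y => Real.log (y + ε)) c)).re +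
      (Real.log l + 1) * (τ b).re - l * ((τ c).re + ε) ≤ 0 := by
  set g : ℝ → ℝ := fun y => Real.log (y + ε) with hgdef
  have hg : ContinuousOn g (Set.Icc 0 1) :=
    (continuousOn_log_add hε).mono Set.Icc_subset_Ici_self
  have hb' : IsSelfAdjoint b := .of_nonneg hb
  have hτb : 0 ≤ (τ b).re := hτ.re_nonneg hb
  refine le_of_forall_pos_le_add fun δ' hδ' => ?_
  set δ : ℝ := δ' / ((τ b).re + l) with hδdef
  have hδ : 0 < δ := by positivity
  obtain ⟨n, Φ, y, hΦ, hy, hsum, hG, hY⟩ := exists_partition_approx hc hc1 hg hδ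
  have hterm : ∀ k, (τ ((cfc Real.negMulLog b + (g (y k) + (Real.log l + 1)) • b -
      (l * (y k + ε)) • (1 : A)) * Φ k)).re ≤ 0 := by
    intro k
    have hle : cfc Real.negMulLog b + (g (y k) + (Real.log l + 1)) • b -
        (l * (y k + ε)) • (1 : A) ≤ 0 := by
      have e : cfc (fun x => Real.negMulLog x + (g (y k) + (Real.log l + 1)) * x -
          l * (y k + ε)) b = cfc Real.negMulLog b + (g (y k) + (Real.log l + 1)) • b -
          (l * (y k + ε)) • (1 : A) := by
        rw [cfc_sub _ _ b (by fun_prop) (by fun_prop), cfc_add .., cfc_const_mul _ _ b,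
          cfc_id' ℝ b, cfc_const _ b, Algebra.algebraMap_eq_smul_one]
      rw [← e]
      have hpos : 0 < y k + ε := by have := (hy k).1; positivity
      exact cfc_nonpos _ b fun x hx => mul_log_add_le_neg_negMulLog
        (spectrum_nonneg_of_nonneg hb hx) hpos hl
    have := hτ.re_mul_le_mul (hΦ k) hle
    rwa [mul_zero, map_zero, Complex.zero_re, hτ.trace] at this
  have htot := Finset.sum_nonpos fun k (_ : k ∈ Finset.univ) => hterm k
  have e1 : ∑ k, (τ ((cfc Real.negMulLog b + (g (y k) + (Real.log l + 1)) • b -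
      (l * (y k + ε)) • (1 : A)) * Φ k)).re = traceEta τ b + (τ (b * ∑ k, g (y k) • Φ k)).re +
      (Real.log l + 1) * (τ b).re - l * ((τ (∑ k, y k • Φ k)).re + ε) := by
    have e2 : ∑ k, ((cfc Real.negMulLog b + (g (y k) + (Real.log l + 1)) • b -
        (l * (y k + ε)) • (1 : A)) * Φ k) = cfc Real.negMulLog b + b * ∑ k, g (y k) • Φ k +
        (Real.log l + 1) • b - l • (∑ k, y k • Φ k + ε • (1 : A)) := by
      have e3 : ∀ k, (cfc Real.negMulLog b + (g (y k) + (Real.log l + 1)) • b -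
        (l * (y k + ε)) • (1 : A)) * Φ k = (cfc Real.negMulLog b + (Real.log l + 1) • b -
          (l * ε) • (1 : A)) * Φ k + b * (g (y k) • Φ k) - l • (y k • Φ k) := by
        intro k
        simp only [add_mul, sub_mul, add_smul, smul_mul_assoc, mul_smul_comm, one_mul, mul_add,
          mul_smul]
        abel
      rw [Finset.sum_congr rfl fun k _ => e3 k, Finset.sum_sub_distrib, Finset.sum_add_distrib,
        ← Finset.mul_sum, ← Finset.mul_sum, ← Finset.smul_sum, hsum, mul_one, smul_add, mul_smul]
      abel
    rw [← Complex.re_sum, ← map_sum, e2]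
    simp only [map_add, map_sub, Complex.add_re, Complex.sub_re, re_smul, hτ.re_one, mul_one,
      traceEta]
  rw [e1] at htot
  have saΦ : ∀ r : Fin n → ℝ, IsSelfAdjoint (∑ k, r k • Φ k) := fun r =>
    isSelfAdjoint_sum _ fun k _ => (IsSelfAdjoint.all (r k)).smul (IsSelfAdjoint.of_nonneg (hΦ k))
  have d1 := hτ.re_mul_le_norm hb ((cfc_predicate g c).sub (saΦ fun k => g (y k))) hG
  have d2 := hτ.re_mul_le_norm (a := 1) (δ := δ) zero_le_one
    ((saΦ y).sub (IsSelfAdjoint.of_nonneg hc)) (by rw [norm_sub_rev]; exact hY)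
  rw [mul_sub, map_sub, Complex.sub_re] at d1
  rw [one_mul, map_sub, Complex.sub_re, hτ.re_one, mul_one] at d2
  have d3 := mul_le_mul_of_nonneg_left d2 hl.le
  have d4 : δ * ((τ b).re + l) = δ' := by rw [hδdef]; field_simp
  linarith

theorem negMulLog_bound {t ε : ℝ} (ht : 0 ≤ t) (hε : 0 < ε) :
    |t * Real.log (t + ε) + Real.negMulLog t| ≤ ε := by
  rcases ht.eq_or_lt with rfl | ht
  · simpa using hε.le
  · have e : t * Real.log (t + ε) + Real.negMulLog t = t * Real.log ((t + ε) / t) := by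
      rw [Real.log_div (by positivity) ht.ne', Real.negMulLog]; ring
    rw [e, abs_of_nonneg (mul_nonneg ht.le (Real.log_nonneg (by
      rw [le_div_iff₀ ht]; linarith)))]
    have h := Real.log_le_sub_one_of_pos (show 0 < (t + ε) / t by positivity)
    have h2 := mul_le_mul_of_nonneg_left h ht.le
    have h3 : t * ((t + ε) / t - 1) = ε := by field_simp; ring
    linarith

/-- `τ (a log (a + ε))` is within `ε` of `-τ η(a)`. -/
theorem abs_re_mul_log_add (hτ : IsFaithfulTracialState τ) {a : A} (ha : 0 ≤ a) {ε : ℝ}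
    (hε : 0 < ε) : |(τ (a * cfc (fun y => Real.log (y + ε)) a)).re + traceEta τ a| ≤ ε := by
  have ha' : IsSelfAdjoint a := .of_nonneg ha
  have hlog := (continuousOn_log_add hε).mono (spectrum_subset_Ici ha)
  have e : a * cfc (fun y => Real.log (y + ε)) a + cfc Real.negMulLog a =
      cfc (fun t => t * Real.log (t + ε) + Real.negMulLog t) a := by
    have hm : ContinuousOn (fun t => t * Real.log (t + ε)) (spectrum ℝ a) :=
      continuousOn_id.mul hlog
    rw [cfc_add a (fun t => t * Real.log (t + ε)) Real.negMulLog hm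
      Real.continuous_negMulLog.continuousOn, cfc_mul _ _ _ (by fun_prop) hlog, cfc_id' ℝ a]
  have hn : ‖a * cfc (fun y => Real.log (y + ε)) a + cfc Real.negMulLog a‖ ≤ ε := by
    rw [e]
    exact norm_cfc_le hε.le fun t ht =>
      negMulLog_bound (spectrum_nonneg_of_nonneg ha ht) hε
  have hsa : IsSelfAdjoint (a * cfc (fun y => Real.log (y + ε)) a + cfc Real.negMulLog a) := by
    rw [e]; exact cfc_predicate _ a
  have h1 := hτ.re_mul_le_norm (a := 1) zero_le_one hsa hn
  have h2 := hτ.re_mul_le_norm (a := 1) (δ := ε) zero_le_one hsa.neg (by rwa [norm_neg])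
  rw [one_mul, hτ.re_one, mul_one] at h1 h2
  rw [map_neg, Complex.neg_re] at h2
  rw [map_add, Complex.add_re] at h1 h2
  rw [abs_le]
  have h3 : traceEta τ a = (τ (cfc Real.negMulLog a)).re := rfl
  constructor <;> linarith

theorem log_add_mono {a b : A} (ha : 0 ≤ a) (hab : a ≤ b) {ε : ℝ} (hε : 0 < ε) :
    cfc (fun y => Real.log (y + ε)) a ≤ cfc (fun y => Real.log (y + ε)) b := by
  have key : ∀ x : A, 0 ≤ x →
      cfc (fun y => Real.log (y + ε)) x = CFC.log (x + algebraMap ℝ A ε) := by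
    intro x hx
    have hx' : IsSelfAdjoint x := .of_nonneg hx
    have e : x + algebraMap ℝ A ε = cfc (fun y => y + ε) x := by
      rw [cfc_add_const _ _ x (by fun_prop), cfc_id' ℝ x]
    have hlog : ContinuousOn Real.log ((fun y => y + ε) '' spectrum ℝ x) := by
      rintro t ⟨s, hs, rfl⟩
      have : (0 : ℝ) ≤ s := spectrum_nonneg_of_nonneg hx hs
      exact (Real.continuousAt_log (by positivity)).continuousWithinAt
    rw [CFC.log, e, ← cfc_comp' Real.log (fun y => y + ε) x hlog]
  rw [key a ha, key b (ha.trans hab)]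
  have hpos : IsStrictlyPositive (algebraMap ℝ A ε) := by grind
  exact CFC.log_le_log (by gcongr) (hpos.nonneg_add ha)

/-- `τ η` is subadditive on positive elements, since the logarithm is operator monotone. -/
theorem traceEta_add_le (hτ : IsFaithfulTracialState τ) {a b : A} (ha : 0 ≤ a) (hb : 0 ≤ b) :
    traceEta τ (a + b) ≤ traceEta τ a + traceEta τ b := by
  refine le_of_forall_pos_le_add fun δ hδ => ?_
  have hε : 0 < δ / 3 := by positivity
  have h1 := abs_le.1 (hτ.abs_re_mul_log_add ha hε)
  have h2 := abs_le.1 (hτ.abs_re_mul_log_add hb hε)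
  have h3 := abs_le.1 (hτ.abs_re_mul_log_add (add_nonneg ha hb) hε)
  have h4 := hτ.re_mul_le_mul ha (log_add_mono ha (le_add_of_nonneg_right hb) hε)
  have h5 := hτ.re_mul_le_mul hb (log_add_mono hb (le_add_of_nonneg_left ha) hε)
  rw [add_mul, map_add, Complex.add_re] at h3
  linarith [h1.1, h2.1, h3.2]

theorem traceEta_sum_le (hτ : IsFaithfulTracialState τ) {ι : Type*} (s : Finset ι) (b : ι → A)
    (hb : ∀ i ∈ s, 0 ≤ b i) : traceEta τ (∑ i ∈ s, b i) ≤ ∑ i ∈ s, traceEta τ (b i) := by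
  classical
  induction s using Finset.induction_on with
  | empty => simp [traceEta, cfc_apply_zero]
  | insert i s his ih =>
    rw [Finset.sum_insert his, Finset.sum_insert his]
    refine (hτ.traceEta_add_le (hb i (by simp)) (Finset.sum_nonneg fun j hj =>
      hb j (by simp [hj]))).trans ?_
    gcongr
    exact ih fun j hj => hb j (by simp [hj])


/-- `x⋆ x` and `x x⋆` have the same moments under a trace, hence, by the Weierstrass
approximation theorem, the same entropy. -/
theorem traceEta_star_mul_self (hτ : IsFaithfulTracialState τ) (x : A) :
    traceEta τ (star x * x) = traceEta τ (x * star x) := by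
  have approx : ∀ {δ : ℝ} {p : Polynomial ℝ} {a : A}, 0 < δ → 0 ≤ a → ‖a‖ ≤ ‖x‖ * ‖x‖ →
      (∀ t ∈ Set.Icc 0 (‖x‖ * ‖x‖), |p.eval t - Real.negMulLog t| < δ) →
      |(τ (Polynomial.aeval a p)).re - traceEta τ a| ≤ δ := by
    intro δ p a hδ ha han hp
    have ha' : IsSelfAdjoint a := .of_nonneg ha
    have e : Polynomial.aeval a p - cfc Real.negMulLog a =
        cfc (fun t => p.eval t - Real.negMulLog t) a := by
      rw [cfc_sub (fun t => p.eval t) Real.negMulLog a (by fun_prop) (by fun_prop),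
        cfc_polynomial p a]
    have hn : ‖Polynomial.aeval a p - cfc Real.negMulLog a‖ ≤ δ := by
      rw [e]
      refine norm_cfc_le hδ.le fun t ht => (hp t ⟨spectrum_nonneg_of_nonneg ha ht, ?_⟩).le
      have h1 := (le_algebraMap_iff_spectrum_le (r := ‖a‖) (a := a)).1
        (IsSelfAdjoint.le_algebraMap_norm_self ha') t ht
      exact h1.trans han
    have hsa : IsSelfAdjoint (Polynomial.aeval a p - cfc Real.negMulLog a) := by
      rw [e]; exact cfc_predicate _ a
    have h1 := hτ.re_mul_le_norm (a := 1) (δ := δ) zero_le_one hsa hn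
    have h2 := hτ.re_mul_le_norm (a := 1) (δ := δ) zero_le_one hsa.neg (by rwa [norm_neg])
    rw [one_mul, hτ.re_one, mul_one] at h1 h2
    rw [LinearMap.map_neg, Complex.neg_re] at h2
    rw [map_sub, Complex.sub_re] at h1 h2
    have h3 : traceEta τ a = (τ (cfc Real.negMulLog a)).re := rfl
    rw [abs_le]
    constructor <;> linarith
  refine eq_of_forall_dist_le fun δ hδ => ?_
  obtain ⟨p, hp⟩ := exists_polynomial_near_of_continuousOn 0 (‖x‖ * ‖x‖) Real.negMulLog
    Real.continuous_negMulLog.continuousOn (δ / 2) (by positivity)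
  have h1 := abs_le.1 (approx (half_pos hδ) (star_mul_self_nonneg x)
    CStarRing.norm_star_mul_self.le hp)
  have h2 := abs_le.1 (approx (half_pos hδ) (mul_star_self_nonneg x)
    CStarRing.norm_self_mul_star.le hp)
  rw [hτ.aeval_star_mul_self] at h1
  rw [Real.dist_eq, abs_le]
  constructor <;> linarith [h1.1, h1.2, h2.1, h2.2]

/-- For a partition of unity `a` and elements `u` with `∑ u_g u_g⋆ = 1`, compressing each `aᵢ` by
the `u_g` increases the total entropy by at most `∑ η(τ(u_g u_g⋆))`. -/
theorem sum_traceEta_conj_sub_le (hτ : IsFaithfulTracialState τ) {ι κ : Type*} [Fintype ι]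
    [Fintype κ] {a : ι → A} (ha : ∀ i, 0 ≤ a i) (hsum : ∑ i, a i = 1) {u : κ → A}
    (hu : ∑ g, u g * star (u g) = 1) :
    ∑ i, (∑ g, traceEta τ (star (u g) * a i * u g) - traceEta τ (a i)) ≤
      ∑ g, Real.negMulLog (τ (u g * star (u g))).re := by
  set t : ι → A := fun i => CFC.sqrt (a i) with ht
  have hts : ∀ i, star (t i) = t i := fun i => (IsSelfAdjoint.of_nonneg (CFC.sqrt_nonneg (a i)))
  have htt : ∀ i, t i * t i = a i := fun i => CFC.sqrt_mul_sqrt_self (a i) (ha i)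
  set b : ι → κ → A := fun i g => t i * u g * star (t i * u g) with hb
  have hb0 : ∀ i g, 0 ≤ b i g := fun i g => mul_star_self_nonneg _
  have hbS : ∀ i g, traceEta τ (star (u g) * a i * u g) = traceEta τ (b i g) := by
    intro i g
    rw [hb, ← hτ.traceEta_star_mul_self, star_mul, hts, ← htt]
    simp only [mul_assoc]
  have hb' : ∀ i g, b i g = t i * (u g * star (u g)) * t i := by
    intro i g
    simp only [hb, star_mul, hts, mul_assoc]
  have hbτ : ∀ i g, τ (b i g) = τ (u g * star (u g) * a i) := by
    intro i g
    rw [hb', hτ.trace, ← mul_assoc, htt, hτ.trace]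
  have hbg : ∀ i, ∑ g, b i g = a i := by
    intro i
    simp only [hb']
    rw [← Finset.sum_mul, ← Finset.mul_sum, hu, mul_one, htt]
  have hbi : ∀ g, ∑ i, (τ (b i g)).re = (τ (u g * star (u g))).re := by
    intro g
    simp only [hbτ]
    rw [← Complex.re_sum, ← map_sum, ← Finset.mul_sum, hsum, mul_one]
  have hai : ∑ i, (τ (a i)).re = 1 := by
    rw [← Complex.re_sum, ← map_sum, hsum, hτ.re_one]
  have hug : ∑ g, (τ (u g * star (u g))).re = 1 := by
    rw [← Complex.re_sum, ← map_sum, hu, hτ.re_one]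
  have ha1 : ∀ i, a i ≤ 1 := fun i => hsum ▸ Finset.single_le_sum (fun j _ => ha j)
    (Finset.mem_univ i)
  refine le_of_forall_pos_le_add fun δ hδ => ?_
  obtain ⟨ε, hε, hεδ⟩ : ∃ ε : ℝ, 0 < ε ∧ 2 * (Fintype.card ι * ε) ≤ δ := by
    refine ⟨δ / (2 * (Fintype.card ι + 1)), by positivity, ?_⟩
    rw [← mul_assoc, ← mul_div_assoc, div_le_iff₀ (by positivity)]
    nlinarith
  -- Klein's inequality with the scale `τ(u_g u_g⋆)`, independent of `i`
  have hk : ∀ g i, traceEta τ (b i g) +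
      (τ (b i g * cfc (fun y => Real.log (y + ε)) (a i))).re +
      (Real.log (τ (u g * star (u g))).re + 1) * (τ (b i g)).re -
      (τ (u g * star (u g))).re * ((τ (a i)).re + ε) ≤ 0 := by
    intro g i
    rcases (hτ.re_nonneg (mul_star_self_nonneg (u g))).eq_or_lt with h0 | hpos
    · have hu0 : u g = 0 := by
        refine hτ.eq_zero_of_re ?_
        rw [hτ.trace, h0]
      have hb00 : b i g = 0 := by simp [hb, hu0]
      simp [hu0, hb00, traceEta, cfc_apply_zero]
    · exact hτ.klein (hb0 i g) (ha i) (ha1 i) hε hpos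
  have hk2 : ∀ g, ∑ i, traceEta τ (b i g) +
      ∑ i, (τ (b i g * cfc (fun y => Real.log (y + ε)) (a i))).re ≤
      Real.negMulLog (τ (u g * star (u g))).re +
        (τ (u g * star (u g))).re * (Fintype.card ι * ε) := by
    intro g
    have h := Finset.sum_nonpos fun i (_ : i ∈ Finset.univ) => hk g i
    rw [Finset.sum_sub_distrib, Finset.sum_add_distrib, Finset.sum_add_distrib, ← Finset.mul_sum,
      ← Finset.mul_sum, hbi, Finset.sum_add_distrib, hai, Finset.sum_const, Finset.card_univ,
      nsmul_eq_mul] at h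
    rw [Real.negMulLog]
    linarith
  have hk3 := Finset.sum_le_sum fun g (_ : g ∈ Finset.univ) => hk2 g
  have hlog : ∑ g, ∑ i, (τ (b i g * cfc (fun y => Real.log (y + ε)) (a i))).re =
      ∑ i, (τ (a i * cfc (fun y => Real.log (y + ε)) (a i))).re := by
    rw [Finset.sum_comm]
    refine Finset.sum_congr rfl fun i _ => ?_
    rw [← Complex.re_sum, ← map_sum, ← Finset.sum_mul, hbg]
  have hlow : ∑ i, (-traceEta τ (a i) - ε) ≤
      ∑ i, (τ (a i * cfc (fun y => Real.log (y + ε)) (a i))).re :=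
    Finset.sum_le_sum fun i _ => by
      have := (abs_le.1 (hτ.abs_re_mul_log_add (ha i) hε)).1
      linarith
  rw [Finset.sum_add_distrib, Finset.sum_add_distrib, hlog, ← Finset.sum_mul, hug, one_mul,
    Finset.sum_comm] at hk3
  rw [Finset.sum_sub_distrib, Finset.sum_neg_distrib, Finset.sum_const, Finset.card_univ,
    nsmul_eq_mul] at hlow
  simp only [hbS, Finset.sum_sub_distrib]
  linarith

end Order

theorem exists_star_mul_self_of_sum {ι : Type*} (s : Finset ι) (y : ι → A) :
    ∃ z, ∑ i ∈ s, star (y i) * y i = star z * z := by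
  let _ := CStarAlgebra.spectralOrder A
  let _ := CStarAlgebra.spectralOrderedRing A
  exact CStarAlgebra.nonneg_iff_eq_star_mul_self.1
    (Finset.sum_nonneg fun i _ => star_mul_self_nonneg (y i))

theorem traceEta_map {B : Type*} [CStarAlgebra B] {σ : B →ₗ[ℂ] ℂ} (φ : A →⋆ₐ[ℂ] B)
    (hφ : ∀ x, σ (φ x) = τ x) {x : A} (hx : IsSelfAdjoint x) :
    traceEta σ (φ x) = traceEta τ x := by
  have h : φ (cfc Real.negMulLog x) = cfc Real.negMulLog (φ x) :=
    StarAlgHomClass.map_cfc φ Real.negMulLog x (by fun_prop) 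
      (AddMonoidHomClass.continuous_of_bound φ 1 fun y => by
        simpa using NonUnitalStarAlgHom.norm_apply_le φ y) hx (hx.map φ)
  rw [traceEta, ← h, hφ, traceEta]

/-- The entropy estimate behind the theorem: for a completely positive map of the form
`a ↦ ∑ β_g(u_g⋆ a u_g)` with trace preserving automorphisms `β_g`, the entropy of a partition of
unity grows by at most `∑ η(τ(u_g u_g⋆))`. -/
theorem sum_traceEta_sub_le (hτ : IsFaithfulTracialState τ) {ι κ : Type*} [Fintype ι]
    [Fintype κ] {a : ι → A} (ha : ∀ i, ∃ y, a i = star y * y) (hsum : ∑ i, a i = 1) {u : κ → A}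
    (hu : ∑ g, u g * star (u g) = 1) (β : κ → A ≃⋆ₐ[ℂ] A) (hβ : ∀ g x, τ (β g x) = τ x) :
    ∑ i, (traceEta τ (∑ g, β g (star (u g) * a i * u g)) - traceEta τ (a i)) ≤
      ∑ g, Real.negMulLog (τ (u g * star (u g))).re := by
  let _ := CStarAlgebra.spectralOrder A
  let _ := CStarAlgebra.spectralOrderedRing A
  have ha0 : ∀ i, 0 ≤ a i := fun i => CStarAlgebra.nonneg_iff_eq_star_mul_self.2 (ha i)
  refine (Finset.sum_le_sum fun i _ => ?_).trans (hτ.sum_traceEta_conj_sub_le ha0 hsum hu)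
  have hc : ∀ g, 0 ≤ star (u g) * a i * u g := fun g => star_left_conjugate_nonneg (ha0 i) _
  gcongr
  refine (hτ.traceEta_sum_le _ _ fun g _ => ?_).trans (Finset.sum_le_sum fun g _ => ?_)
  · obtain ⟨y, hy⟩ := CStarAlgebra.nonneg_iff_eq_star_mul_self.1 (hc g)
    rw [hy, map_mul, map_star]
    exact star_mul_self_nonneg _
  · exact (traceEta_map (β g : A →⋆ₐ[ℂ] A) (hβ g) (.of_nonneg (hc g))).le

end IsFaithfulTracialState

/-! ### Automorphisms of a finite factor preserve the trace -/

section WeakLimits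

open Filter Topology

variable {A : Type*} [CStarAlgebra A]

/-- `y` is the limit of the sequence `x` along a fixed free ultrafilter on `ℕ`, in the weak
topology defined by the functionals `τ (w * ·)`. -/
def IsWeakUltralimit (τ : A →ₗ[ℂ] ℂ) (x : ℕ → A) (y : A) : Prop :=
  ∀ w, Tendsto (fun n => τ (w * x n)) (hyperfilter ℕ) (𝓝 (τ (w * y)))

/-- Every bounded sequence has a weak ultralimit. For a faithful normal tracial state on a von
Neumann algebra this expresses the weak compactness of balls, and is the only form in which
normality is used. -/
def HasWeakUltralimits (τ : A →ₗ[ℂ] ℂ) : Prop :=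
  ∀ (x : ℕ → A) (R : ℝ), (∀ n, ‖x n‖ ≤ R) → ∃ y, IsWeakUltralimit τ x y

theorem eventually_hyperfilter_ge (k : ℕ) : ∀ᶠ n in (hyperfilter ℕ : Filter ℕ), k ≤ n :=
  (eventually_ge_atTop k).filter_mono Nat.hyperfilter_le_atTop

namespace IsFaithfulTracialState

variable {τ : A →ₗ[ℂ] ℂ}

theorem automorphism_real_smul (α : A ≃⋆ₐ[ℂ] A) (r : ℝ) (x : A) : α (r • x) = r • α x := by
  rw [← Complex.coe_smul, ← Complex.coe_smul, map_smul]

theorem tendsto_re_of_isWeakUltralimit {x : ℕ → A} {y : A} (h : IsWeakUltralimit τ x y) :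
    Tendsto (fun n => (τ (x n)).re) (hyperfilter ℕ) (𝓝 (τ y).re) := by
  have := (Complex.continuous_re.tendsto _).comp (h 1)
  simpa only [one_mul, Function.comp_def] using this

section Order

variable [PartialOrder A] [StarOrderedRing A]

theorem norm_star_mul_le (hτ : IsFaithfulTracialState τ) (w z : A) :
    ‖τ (star w * z)‖ ≤ √(τ (star w * w)).re * √(τ (star z * z)).re :=
  let f : A →ₚ[ℂ] ℂ := PositiveLinearMap.mk₀ τ fun _ h => hτ.map_nonneg h
  norm_inner_le_norm (𝕜 := ℂ) (f.toPreGNS w) (f.toPreGNS z)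

theorem nonneg_of_isWeakUltralimit (hτ : IsFaithfulTracialState τ) {x : ℕ → A} {y : A}
    (h : IsWeakUltralimit τ x y) (hx : ∀ᶠ n in (hyperfilter ℕ : Filter ℕ), 0 ≤ x n) : 0 ≤ y := by
  have hsa : IsSelfAdjoint y := by
    refine hτ.eq_of_forall_mul fun w => ?_
    have h1 : τ (w * star y) = star (τ (star w * y)) := by
      rw [← hτ.apply_star, star_mul, star_star, hτ.trace]
    rw [h1]
    refine tendsto_nhds_unique (((continuous_star.tendsto _).comp (h (star w)))) ?_
    refine (h w).congr' ?_
    filter_upwards [hx] with n hn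
    rw [Function.comp_apply, ← hτ.apply_star, star_mul, star_star,
      (IsSelfAdjoint.of_nonneg hn).star_eq, hτ.trace]
  have hneg : 0 ≤ (τ (y⁻ * y)).re := by
    refine ge_of_tendsto ((Complex.continuous_re.tendsto _).comp (h y⁻)) ?_
    filter_upwards [hx] with n hn
    exact hτ.re_mul_nonneg (CFC.negPart_nonneg y) hn
  have e : y⁻ * y = -(star y⁻ * y⁻) := by
    nth_rewrite 2 [← CFC.posPart_sub_negPart y hsa]
    rw [mul_sub, CFC.negPart_mul_posPart, zero_sub,
      (IsSelfAdjoint.of_nonneg (CFC.negPart_nonneg y)).star_eq]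
  rw [e, map_neg, Complex.neg_re] at hneg
  have h0 : y⁻ = 0 := hτ.eq_zero_of_re (le_antisymm (by linarith) (hτ.re_star_mul_self _))
  rw [← CFC.posPart_sub_negPart y hsa, h0, sub_zero]
  exact CFC.posPart_nonneg y

theorem le_of_isWeakUltralimit (hτ : IsFaithfulTracialState τ) {x : ℕ → A} {y b : A}
    (h : IsWeakUltralimit τ x y) (hx : ∀ᶠ n in (hyperfilter ℕ : Filter ℕ), x n ≤ b) : y ≤ b := by
  refine sub_nonneg.1 (hτ.nonneg_of_isWeakUltralimit (x := fun n => b - x n) (fun w => ?_) ?_)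
  · simp only [mul_sub, map_sub]
    exact tendsto_const_nhds.sub (h w)
  · filter_upwards [hx] with n hn using sub_nonneg.2 hn

theorem ge_of_isWeakUltralimit (hτ : IsFaithfulTracialState τ) {x : ℕ → A} {y b : A}
    (h : IsWeakUltralimit τ x y) (hx : ∀ᶠ n in (hyperfilter ℕ : Filter ℕ), b ≤ x n) : b ≤ y := by
  refine sub_nonneg.1 (hτ.nonneg_of_isWeakUltralimit (x := fun n => x n - b) (fun w => ?_) ?_)
  · simp only [mul_sub, map_sub]
    exact (h w).sub tendsto_const_nhds
  · filter_upwards [hx] with n hn using sub_nonneg.2 hn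

theorem eq_one_of_re (hτ : IsFaithfulTracialState τ) {y : A} (hy : y ≤ 1) (h : 1 ≤ (τ y).re) :
    y = 1 := by
  obtain ⟨s, hs⟩ := CStarAlgebra.nonneg_iff_eq_star_mul_self.1 (sub_nonneg.2 hy)
  have h1 : (τ (star s * s)).re = 0 := by
    refine le_antisymm ?_ (hτ.re_star_mul_self s)
    rw [← hs, map_sub, Complex.sub_re, hτ.re_one]
    linarith
  rw [hτ.eq_zero_of_re h1, mul_zero] at hs
  exact (sub_eq_zero.1 hs).symm

theorem inverse_one_add {s : A} (hs : 0 ≤ s) : IsStrictlyPositive (1 + s) :=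
  IsStrictlyPositive.add_nonneg (by grind) hs

theorem one_add_mul_inverse {s : A} (hs : 0 ≤ s) :
    Ring.inverse (1 + s) + s * Ring.inverse (1 + s) = 1 := by
  have := Ring.mul_inverse_cancel _ (inverse_one_add hs).isUnit
  rwa [add_mul, one_mul] at this

theorem inverse_mul_one_add {s : A} (hs : 0 ≤ s) :
    Ring.inverse (1 + s) + Ring.inverse (1 + s) * s = 1 := by
  have := Ring.inverse_mul_cancel _ (inverse_one_add hs).isUnit
  rwa [mul_add, mul_one] at this

theorem inverse_one_add_anti {s t : A} (hs : 0 ≤ s) (hst : s ≤ t) :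
    Ring.inverse (1 + t) ≤ Ring.inverse (1 + s) :=
  CStarAlgebra.ringInverse_le_ringInverse (by gcongr) (inverse_one_add hs)

theorem inverse_one_add_nonneg {s : A} (hs : 0 ≤ s) : 0 ≤ Ring.inverse (1 + s) := by
  have h := star_left_conjugate_nonneg (inverse_one_add hs).nonneg (Ring.inverse (1 + s))
  rwa [mul_assoc, Ring.mul_inverse_cancel _ (inverse_one_add hs).isUnit, mul_one, star_nonneg_iff]
    at h

theorem inverse_one_add_le_one {s : A} (hs : 0 ≤ s) : Ring.inverse (1 + s) ≤ 1 := by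
  simpa using inverse_one_add_anti le_rfl hs

theorem one_sub_le_inverse_one_add {s : A} (hs : 0 ≤ s) : 1 - s ≤ Ring.inverse (1 + s) := by
  have h := star_left_conjugate_nonneg (inverse_one_add_nonneg hs) s
  have e1 := one_add_mul_inverse hs
  have e2 := inverse_mul_one_add hs
  have e : star s * Ring.inverse (1 + s) * s = Ring.inverse (1 + s) - (1 - s) := by
    rw [(IsSelfAdjoint.of_nonneg hs).star_eq, eq_sub_of_add_eq' e1, sub_mul, one_mul,
      eq_sub_of_add_eq' e2]
    abel
  rw [e] at h
  exact sub_nonneg.1 h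

/-- A ⋆-automorphism, being an order isomorphism, is absolutely continuous for the trace:
positive contractions of small trace cannot have images of large trace. The elements
`(1 + ∑_{m = n}^{n+k} a_m)⁻¹` play the role of the complement of `sup_{m ≥ n} a_m`: their limits
`r_n` over `k` increase to `1`, so the images of the `r_n` increase to `1` too, whereas the
trace of the image of `r_n` stays below `1 - δ / 2`. -/
theorem not_forall_le_map (hτ : IsFaithfulTracialState τ) (hw : HasWeakUltralimits τ)
    (α : A ≃⋆ₐ[ℂ] A) {δ : ℝ} (hδ : 0 < δ) {a : ℕ → A} (ha : ∀ n, 0 ≤ a n) (ha1 : ∀ n, a n ≤ 1)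
    (hsmall : ∀ n, (τ (a n)).re ≤ (1 / 2) ^ n) (hlarge : ∀ n, δ ≤ (τ (α (a n))).re) : False := by
  have hα : ∀ {x y : A}, x ≤ y → α x ≤ α y := fun h => OrderHomClass.mono α h
  set s : ℕ → ℕ → A := fun n k => ∑ m ∈ Finset.range k, a (n + m) with hsdef
  have hs : ∀ n k, 0 ≤ s n k := fun n k => Finset.sum_nonneg fun m _ => ha _
  have hsmono : ∀ n {k l}, k ≤ l → s n k ≤ s n l := fun n k l hkl =>
    Finset.sum_le_sum_of_subset_of_nonneg (Finset.range_mono hkl) fun m _ _ => ha _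
  have hsucc : ∀ n k, s (n + 1) k ≤ s n (k + 1) := by
    intro n k
    simp only [hsdef]
    rw [Finset.sum_range_succ']
    refine le_add_of_le_of_nonneg (le_of_eq (Finset.sum_congr rfl fun m _ => ?_)) (ha _)
    congr 1
    ring
  have hτs : ∀ n k, (τ (s n k)).re ≤ 2 * (1 / 2) ^ n := by
    intro n k
    simp only [hsdef]
    rw [map_sum, Complex.re_sum]
    calc _ ≤ ∑ m ∈ Finset.range k, (1 / 2 : ℝ) ^ (n + m) := Finset.sum_le_sum fun m _ => hsmall _
      _ = (1 / 2) ^ n * ∑ m ∈ Finset.range k, (1 / 2 : ℝ) ^ m := by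
        rw [Finset.mul_sum]; exact Finset.sum_congr rfl fun m _ => pow_add _ _ _
      _ ≤ (1 / 2) ^ n * 2 := by
        gcongr
        exact sum_geometric_two_le k
      _ = _ := mul_comm _ _
  have norm_le : ∀ {x : A}, 0 ≤ x → x ≤ 1 → ‖x‖ ≤ 1 := fun h0 h1 =>
    (CStarAlgebra.norm_le_one_iff_of_nonneg _ h0).2 h1
  choose r hr using fun n => hw (fun k => Ring.inverse (1 + s n k)) 1 fun k =>
    norm_le (inverse_one_add_nonneg (hs n k)) (inverse_one_add_le_one (hs n k))
  have hr0 : ∀ n, 0 ≤ r n := fun n => hτ.ge_of_isWeakUltralimit (hr n)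
    (Eventually.of_forall fun k => inverse_one_add_nonneg (hs n k))
  have hrle : ∀ n k, r n ≤ Ring.inverse (1 + s n k) := fun n k =>
    hτ.le_of_isWeakUltralimit (hr n) (by
      filter_upwards [eventually_hyperfilter_ge k] with l hl
      exact inverse_one_add_anti (hs n k) (hsmono n hl))
  have hr1 : ∀ n, r n ≤ 1 := fun n => (hrle n 0).trans (inverse_one_add_le_one (hs n 0))
  have hrmono : Monotone r := monotone_nat_of_le_succ fun n =>
    hτ.ge_of_isWeakUltralimit (hr (n + 1)) (Eventually.of_forall fun k =>
      (hrle n (k + 1)).trans (inverse_one_add_anti (hs _ k) (hsucc n k)))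
  have hτr : ∀ n, 1 - 2 * (1 / 2) ^ n ≤ (τ (r n)).re := by
    intro n
    refine ge_of_tendsto (tendsto_re_of_isWeakUltralimit (hr n)) (Eventually.of_forall fun k => ?_)
    have := hτ.re_mono (one_sub_le_inverse_one_add (hs n k))
    rw [map_sub, Complex.sub_re, hτ.re_one] at this
    linarith [hτs n k]
  have hταr : ∀ n, (τ (α (r n))).re ≤ 1 - δ / 2 := by
    intro n
    refine (hτ.re_mono (hα (hrle n 1))).trans ?_
    have e : s n 1 = a n := by simp [hsdef]
    rw [e]
    have h1 := congrArg α (one_add_mul_inverse (ha n))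
    rw [map_add, map_mul, _root_.map_one] at h1
    have hhalf : (1 / 2 : ℝ) • (1 : A) ≤ Ring.inverse (1 + a n) := by
      have h2 := one_add_mul_inverse (ha n)
      have h3 := CStarAlgebra.ringInverse_le_ringInverse (a := 1 + a n) (b := 1 + 1)
        (by gcongr; exact ha1 n) (inverse_one_add (ha n))
      have e2 : Ring.inverse (1 + 1 : A) = (1 / 2 : ℝ) • (1 : A) := by
        have h4 : (1 + 1 : A) * (1 / 2 : ℝ) • (1 : A) = 1 := by
          rw [add_mul, one_mul, ← add_smul]
          norm_num
        have h5 := congrArg (Ring.inverse (1 + 1 : A) * ·) h4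
        simpa only [← mul_assoc, Ring.inverse_mul_cancel _
          (inverse_one_add (zero_le_one' A)).isUnit, one_mul, mul_one] using h5.symm
      rwa [e2] at h3
    have h4 := hτ.re_mul_le_mul (OrderHomClass.mono α (ha n) |>.trans_eq' (map_zero α))
      (hα hhalf)
    rw [automorphism_real_smul, _root_.map_one, mul_smul_comm, mul_one, re_smul] at h4
    have h5 := congrArg (fun z => (τ z).re) h1
    simp only [map_add, Complex.add_re, hτ.re_one] at h5
    linarith [hlarge n]
  obtain ⟨L, hL⟩ := hw (fun n => α (r n)) 1 fun n => by
    rw [StarAlgEquiv.norm_map]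
    exact norm_le (hr0 n) (hr1 n)
  have hL1 : α.symm L ≤ 1 := by
    have h1 : L ≤ 1 := hτ.le_of_isWeakUltralimit hL (Eventually.of_forall fun n => by
      simpa using hα (hr1 n))
    simpa using OrderHomClass.mono α.symm h1
  have hLr : ∀ n, r n ≤ α.symm L := fun n => by
    have h1 : α (r n) ≤ L := hτ.ge_of_isWeakUltralimit hL (by
      filter_upwards [eventually_hyperfilter_ge n] with l hl using hα (hrmono hl))
    simpa using OrderHomClass.mono α.symm h1
  have hLτ : 1 ≤ (τ (α.symm L)).re := by
    have h1 : Tendsto (fun n : ℕ => 1 - 2 * (1 / 2 : ℝ) ^ n) atTop (𝓝 (1 - 2 * 0)) :=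
      tendsto_const_nhds.sub ((tendsto_pow_atTop_nhds_zero_of_lt_one (by norm_num)
        (by norm_num)).const_mul 2)
    rw [mul_zero, sub_zero] at h1
    exact le_of_tendsto' h1 fun n => (hτr n).trans (hτ.re_mono (hLr n))
  have hLone : L = 1 := by
    have := congrArg α (hτ.eq_one_of_re hL1 hLτ)
    simpa using this
  have hfin : (τ L).re ≤ 1 - δ / 2 :=
    le_of_tendsto (tendsto_re_of_isWeakUltralimit hL) (Eventually.of_forall hταr)
  rw [hLone, hτ.re_one] at hfin
  linarith

end Order

theorem re_parallelogram (τ : A →ₗ[ℂ] ℂ) (x y : A) :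
    (τ (star (x - y) * (x - y))).re = 2 * (τ (star x * x)).re + 2 * (τ (star y * y)).re -
      4 * (τ (star ((1 / 2 : ℝ) • (x + y)) * ((1 / 2 : ℝ) • (x + y)))).re := by
  rw [star_smul, smul_mul_smul_comm, re_smul]
  simp only [star_add, star_sub, add_mul, mul_add, sub_mul, mul_sub, map_add, map_sub,
    Complex.add_re, Complex.sub_re, star_trivial]
  ring

/-- In a factor, an element of trace `0` has, subject to constraints that are convex and invariant
under unitary conjugation, modifications of arbitrarily small `2`-norm. A minimizing sequence is
Cauchy in the `2`-norm and asymptotically commutes with the unitaries, so that its weak limit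
is a scalar of trace `0`. -/
theorem exists_re_star_mul_self_lt (hτ : IsFaithfulTracialState τ) (hw : HasWeakUltralimits τ)
    (hfactor : ∀ z : A, (∀ x, z * x = x * z) → ∃ c : ℂ, z = c • (1 : A)) {K : Set A} {R : ℝ}
    (hK : Convex ℝ K) (hKR : ∀ y ∈ K, ‖y‖ ≤ R) (hKτ : ∀ y ∈ K, τ y = 0)
    (hKu : ∀ y ∈ K, ∀ v ∈ unitary A, v * y * star v ∈ K) (hne : K.Nonempty) {ε : ℝ} (hε : 0 < ε) :
    ∃ y ∈ K, (τ (star y * y)).re < ε := by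
  let _ := CStarAlgebra.spectralOrder A
  let _ := CStarAlgebra.spectralOrderedRing A
  set q : A → ℝ := fun y => (τ (star y * y)).re with hq
  have hq0 : ∀ y, 0 ≤ q y := hτ.re_star_mul_self
  set d : ℝ := sInf (q '' K) with hd
  have hbdd : BddBelow (q '' K) := ⟨0, by rintro _ ⟨y, _, rfl⟩; exact hq0 y⟩
  have hdle : ∀ y ∈ K, d ≤ q y := fun y hy => csInf_le hbdd ⟨y, hy, rfl⟩
  have hex : ∀ n : ℕ, ∃ y ∈ K, q y < d + 1 / ((n : ℝ) + 1) := by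
    intro n
    obtain ⟨_, ⟨y, hy, rfl⟩, h⟩ := exists_lt_of_csInf_lt (hne.image q)
      (lt_add_of_pos_right d (show 0 < 1 / ((n : ℝ) + 1) by positivity))
    exact ⟨y, hy, h⟩
  choose y hyK hyq using hex
  have hpar : ∀ x ∈ K, ∀ z ∈ K, q (x - z) ≤ 2 * (q x - d) + 2 * (q z - d) := by
    intro x hx z hz
    have h1 := re_parallelogram τ x z
    have h2 : (1 / 2 : ℝ) • (x + z) ∈ K := by
      rw [smul_add]
      exact hK hx hz (by norm_num) (by norm_num) (by norm_num)
    have h3 := hdle _ h2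
    simp only [hq] at h3 ⊢
    linarith
  have hlim : Tendsto (fun n : ℕ => 1 / ((n : ℝ) + 1)) (hyperfilter ℕ) (𝓝 0) :=
    tendsto_one_div_add_atTop_nhds_zero_nat.mono_left Nat.hyperfilter_le_atTop
  obtain ⟨y', hy'⟩ := hw y R fun n => hKR _ (hyK n)
  have hcomm : ∀ v ∈ unitary A, v * y' * star v = y' := by
    intro v hv
    refine hτ.eq_of_forall_mul fun w => ?_
    have hconj : ∀ z, τ (w * (v * z * star v)) = τ (star v * w * v * z) := fun z => by
      rw [hτ.trace]
      simp only [mul_assoc]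
      rw [hτ.trace]
      simp only [mul_assoc]
      rw [hτ.trace]
      simp only [mul_assoc]
    have hvv : ∀ z, q (v * z * star v) = q z := fun z => by
      have : star (v * z * star v) * (v * z * star v) = v * (star z * z) * star v := by
        simp only [star_mul, star_star, mul_assoc]
        rw [← mul_assoc (star v) v, Unitary.star_mul_self_of_mem hv, one_mul]
      simp only [hq]
      rw [this, hτ.trace, ← mul_assoc, Unitary.star_mul_self_of_mem hv, one_mul]
    have h1 : Tendsto (fun n => τ (w * (v * y n * star v - y n))) (hyperfilter ℕ)
        (𝓝 (τ (w * (v * y' * star v)) - τ (w * y'))) := by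
      simp only [mul_sub, map_sub, hconj]
      exact (hy' _).sub (hy' _)
    have h2 : Tendsto (fun n => τ (w * (v * y n * star v - y n))) (hyperfilter ℕ) (𝓝 0) := by
      refine squeeze_zero_norm (a := fun n : ℕ =>
        √(τ (star (star w) * star w)).re * √(4 * (1 / ((n : ℝ) + 1)))) (fun n => ?_) ?_
      · have h3 := hτ.norm_star_mul_le (star w) (v * y n * star v - y n)
        rw [star_star] at h3
        rw [star_star]
        refine h3.trans ?_
        gcongr
        have h4 := hpar _ (hKu _ (hyK n) v hv) _ (hyK n)
        rw [hvv] at h4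
        have := hyq n
        simp only [hq] at h4 this
        linarith
      · have := ((hlim.const_mul 4).sqrt).const_mul √(τ (star (star w) * star w)).re
        simpa using this
    exact sub_eq_zero.1 (tendsto_nhds_unique h1 h2)
  have hcentral : ∀ x, y' * x = x * y' := by
    intro x
    have hx : x ∈ Submodule.span ℂ (unitary A : Set A) := by
      rw [CStarAlgebra.span_unitary]; trivial
    induction hx using Submodule.span_induction with
    | mem v hv =>
      nth_rewrite 1 [← hcomm v hv]
      rw [mul_assoc, Unitary.star_mul_self_of_mem hv, mul_one]
    | zero => rw [mul_zero, zero_mul]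
    | add a b _ _ iha ihb => rw [mul_add, add_mul, iha, ihb]
    | smul c a _ iha => rw [mul_smul_comm, smul_mul_assoc, iha]
  obtain ⟨c, hc⟩ := hfactor y' hcentral
  have hτy' : τ y' = 0 := by
    have h1 := hy' 1
    simp only [one_mul, hKτ _ (hyK _)] at h1
    exact tendsto_nhds_unique h1 tendsto_const_nhds
  have hy0 : y' = 0 := by
    rw [hc, map_smul, hτ.map_one, smul_eq_mul, mul_one] at hτy'
    rw [hc, hτy', zero_smul]
  rw [hy0] at hy'
  have hd0 : d ≤ 0 := by
    refine ge_of_tendsto' (x := atTop)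
      (tendsto_one_div_add_atTop_nhds_zero_nat (𝕜 := ℝ)) fun n => ?_
    -- `q (yₙ - yₘ)` is small and `τ (yₙ⋆ yₘ)` tends to `0` with `m`
    have h1 : Tendsto (fun m : ℕ => 2 * (1 / ((n : ℝ) + 1)) + 2 * (1 / ((m : ℝ) + 1)) +
        2 * (τ (star (y n) * y m)).re) (hyperfilter ℕ)
        (𝓝 (2 * (1 / ((n : ℝ) + 1)) + 2 * 0 + 2 * (τ (star (y n) * 0)).re)) :=
      (tendsto_const_nhds.add (hlim.const_mul 2)).add
        (((Complex.continuous_re.tendsto _).comp (hy' (star (y n)))).const_mul 2)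
    have h2 : ∀ m : ℕ, 2 * d ≤ 2 * (1 / ((n : ℝ) + 1)) + 2 * (1 / ((m : ℝ) + 1)) +
        2 * (τ (star (y n) * y m)).re := by
      intro m
      have h3 := hpar _ (hyK n) _ (hyK m)
      have h4 : q (y n - y m) = q (y n) + q (y m) - 2 * (τ (star (y n) * y m)).re := by
        have h5 : (τ (star (y m) * y n)).re = (τ (star (y n) * y m)).re := by
          have : star (y m) * y n = star (star (y n) * y m) := by rw [star_mul, star_star]
          rw [this, hτ.apply_star]
          exact Complex.conj_re _
        simp only [hq, star_sub, sub_mul, mul_sub, map_sub, Complex.sub_re, h5]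
        ring
      have h6 := hyq n
      have h7 := hyq m
      have h8 := hdle _ (hyK n)
      have h9 := hdle _ (hyK m)
      linarith
    have h10 := ge_of_tendsto' h1 h2
    simp only [mul_zero, map_zero, Complex.zero_re, add_zero] at h10
    linarith
  obtain ⟨n, hn⟩ := exists_nat_one_div_lt hε
  exact ⟨y n, hyK n, (hyq n).trans_le (by linarith)⟩

/-- Every ⋆-automorphism of a finite factor preserves the trace. -/
theorem map_automorphism (hτ : IsFaithfulTracialState τ) (hw : HasWeakUltralimits τ)
    (hfactor : ∀ z : A, (∀ x, z * x = x * z) → ∃ c : ℂ, z = c • (1 : A)) (α : A ≃⋆ₐ[ℂ] A) (x : A) :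
    τ (α x) = τ x := by
  let _ := CStarAlgebra.spectralOrder A
  let _ := CStarAlgebra.spectralOrderedRing A
  suffices h : ∀ x, τ x = 0 → τ (α x) = 0 by
    have h1 := h (x - τ x • (1 : A)) (by
      rw [map_sub, map_smul, hτ.map_one, smul_eq_mul, mul_one, sub_self])
    rw [map_sub, map_sub, map_smul, map_smul, _root_.map_one, hτ.map_one, smul_eq_mul,
      mul_one] at h1
    exact sub_eq_zero.1 h1
  intro x hx
  by_contra hne
  have hx0 : x ≠ 0 := by
    rintro rfl
    exact hne (by rw [map_zero, map_zero])
  have hR : 0 < ‖x‖ := norm_pos_iff.2 hx0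
  set K : Set A := {y | ‖y‖ ≤ ‖x‖ ∧ τ y = 0 ∧ τ (α y) = τ (α x)} with hKdef
  have hKconv : Convex ℝ K := by
    rintro y ⟨h1, h2, h3⟩ z ⟨h4, h5, h6⟩ s t hs ht hst
    refine ⟨?_, ?_, ?_⟩
    · refine (norm_add_le _ _).trans ?_
      rw [norm_smul, norm_smul, Real.norm_of_nonneg hs, Real.norm_of_nonneg ht]
      calc s * ‖y‖ + t * ‖z‖ ≤ s * ‖x‖ + t * ‖x‖ := by gcongr
        _ = ‖x‖ := by rw [← add_mul, hst, one_mul]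
    · rw [map_add, LinearMap.map_smul_of_tower, LinearMap.map_smul_of_tower, h2, h5, smul_zero,
        smul_zero, add_zero]
    · rw [map_add, automorphism_real_smul, automorphism_real_smul, map_add,
        LinearMap.map_smul_of_tower,
        LinearMap.map_smul_of_tower, h3, h6, ← add_smul, hst, one_smul]
  have hKu : ∀ y ∈ K, ∀ v ∈ unitary A, v * y * star v ∈ K := by
    rintro y ⟨h1, h2, h3⟩ v hv
    refine ⟨?_, ?_, ?_⟩
    · rwa [CStarRing.norm_mul_mem_unitary _ (Unitary.star_mem hv),
        CStarRing.norm_mem_unitary_mul _ hv]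
    · rw [hτ.trace, ← mul_assoc, Unitary.star_mul_self_of_mem hv, one_mul, h2]
    · rw [map_mul α, map_mul α, hτ.trace, ← mul_assoc, ← map_mul α, Unitary.star_mul_self_of_mem hv,
        _root_.map_one, one_mul, h3]
  have hsmall := fun n : ℕ => hτ.exists_re_star_mul_self_lt hw hfactor hKconv
    (fun y hy => hy.1) (fun y hy => hy.2.1) hKu ⟨x, le_rfl, hx, rfl⟩
    (show 0 < ‖x‖ ^ 2 * (1 / 2) ^ n by positivity)
  choose y hyK hyq using hsmall
  refine hτ.not_forall_le_map hw α (δ := (‖x‖ ^ 2)⁻¹ * ‖τ (α x)‖ ^ 2)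
    (by have := norm_pos_iff.2 hne; positivity)
    (a := fun n => (‖x‖ ^ 2)⁻¹ • (star (y n) * y n))
    (fun n => smul_nonneg (by positivity) (star_mul_self_nonneg _)) (fun n => ?_) (fun n => ?_)
    (fun n => ?_)
  · refine (CStarAlgebra.norm_le_one_iff_of_nonneg _
      (smul_nonneg (by positivity) (star_mul_self_nonneg _))).1 ?_
    rw [norm_smul, CStarRing.norm_star_mul_self, norm_inv, norm_pow, norm_norm,
      inv_mul_le_iff₀ (by positivity), mul_one, sq]
    exact mul_self_le_mul_self (norm_nonneg _) (hyK n).1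
  · rw [re_smul, inv_mul_le_iff₀ (by positivity)]
    exact (hyq n).le
  · rw [automorphism_real_smul, re_smul]
    gcongr
    have h1 := hτ.norm_star_mul_le 1 (α (y n))
    rw [star_one, one_mul, one_mul, hτ.re_one, Real.sqrt_one, one_mul, (hyK n).2.2] at h1
    have h2 := pow_le_pow_left₀ (norm_nonneg _) h1 2
    rwa [Real.sq_sqrt (hτ.re_star_mul_self _), ← map_star, ← map_mul] at h2

end IsFaithfulTracialState

end WeakLimits

/-! ### Weak compactness and the bicommutant -/

theorem summable_norm_mul_norm {E : Type*} [NormedAddCommGroup E] {ξ η : ℕ → E}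
    (hξ : Summable fun n => ‖ξ n‖ ^ 2)
    (hη : Summable fun n => ‖η n‖ ^ 2) : Summable fun n => ‖η n‖ * ‖ξ n‖ :=
  Summable.of_nonneg_of_le (fun n => by positivity)
    (fun n => by nlinarith [sq_nonneg (‖η n‖ - ‖ξ n‖), sq_nonneg (‖η n‖), sq_nonneg (‖ξ n‖)])
    (hη.add hξ)

section Operators

open Filter Topology

variable {H : Type*} [NormedAddCommGroup H] [InnerProductSpace ℂ H] [CompleteSpace H]

/-- Bounded sequences of operators converge along an ultrafilter in the weak operator topology. -/
theorem exists_operator_ultralimit {T : ℕ → H →L[ℂ] H} {R : ℝ} (hT : ∀ n, ‖T n‖ ≤ R) :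
    ∃ S : H →L[ℂ] H, ∀ a b : H,
      Tendsto (fun n => ⟪a, T n b⟫_ℂ) (hyperfilter ℕ) (𝓝 ⟪a, S b⟫_ℂ) := by
  have hbound : ∀ a b n, ‖⟪T n a, b⟫_ℂ‖ ≤ R * ‖a‖ * ‖b‖ := fun a b n =>
    (norm_inner_le_norm _ _).trans (by
      gcongr
      exact (T n).le_of_opNorm_le (hT n) a)
  have hex : ∀ a b, ∃ c ∈ Metric.closedBall (0 : ℂ) (R * ‖a‖ * ‖b‖),
      Tendsto (fun n => ⟪T n a, b⟫_ℂ) (hyperfilter ℕ) (𝓝 c) := by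
    intro a b
    exact (isCompact_closedBall (0 : ℂ) (R * ‖a‖ * ‖b‖)).ultrafilter_le_nhds
      ((hyperfilter ℕ).map fun n => ⟪T n a, b⟫_ℂ) (by
        rw [Ultrafilter.coe_map, le_principal_iff, mem_map]
        exact Eventually.of_forall fun n => by simpa using hbound a b n)
  choose f hf hlim using hex
  let B : H →ₗ⋆[ℂ] H →ₗ[ℂ] ℂ := LinearMap.mk₂'ₛₗ (starRingEnd ℂ) (RingHom.id ℂ) f
    (fun a a' b => tendsto_nhds_unique (hlim (a + a') b) (by
      simpa only [map_add, inner_add_left] using (hlim a b).add (hlim a' b)))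
    (fun c a b => tendsto_nhds_unique (hlim (c • a) b) (by
      simpa only [map_smul, inner_smul_left, smul_eq_mul] using
        (hlim a b).const_smul (starRingEnd ℂ c)))
    (fun a b b' => tendsto_nhds_unique (hlim a (b + b')) (by
      simpa only [inner_add_right] using (hlim a b).add (hlim a b')))
    (fun c a b => tendsto_nhds_unique (hlim a (c • b)) (by
      simpa only [inner_smul_right, smul_eq_mul, RingHom.id_apply] using (hlim a b).const_smul c))
  let S := InnerProductSpace.continuousLinearMapOfBilin (B.mkContinuous₂ R fun a b => by
    simpa using! hf a b)
  refine ⟨S, fun a b => ?_⟩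
  have h1 : ⟪S b, a⟫_ℂ = f b a := InnerProductSpace.continuousLinearMapOfBilin_apply _ _ _
  have h2 := (Complex.continuous_conj.tendsto _).comp (hlim b a)
  rw [← h1, inner_conj_symm] at h2
  refine h2.congr fun n => ?_
  rw [Function.comp_apply, inner_conj_symm]

/-- A normal functional on the bicommutant of a unital self-adjoint set `D` of operators is
determined by its values on any unital subspace stable under multiplication by `D`. In
`ℓ²(ι, K)`, the projection onto the closure of the orbit of the vector defining the functional has
its matrix entries in the commutant of `D`. -/
theorem tsum_inner_eq_zero_of_mem_bicommutant {K ι : Type*} [NormedAddCommGroup K]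
    [InnerProductSpace ℂ K] [CompleteSpace K] {D : Set (K →L[ℂ] K)} (hD : ∀ d ∈ D, star d ∈ D)
    (S : Submodule ℂ (K →L[ℂ] K)) (h1 : 1 ∈ S) (hDS : ∀ d ∈ D, ∀ s ∈ S, d * s ∈ S)
    {T : K →L[ℂ] K} (hT : ∀ P : K →L[ℂ] K, (∀ d ∈ D, d * P = P * d) → P * T = T * P)
    (ξ η : lp (fun _ : ι => K) 2) (hS : ∀ s ∈ S, ∑' i, ⟪η i, s (ξ i)⟫_ℂ = 0) :
    ∑' i, ⟪η i, T (ξ i)⟫_ℂ = 0 := by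
  classical
  let amp : (K →L[ℂ] K) → lp (fun _ : ι => K) 2 →L[ℂ] lp (fun _ : ι => K) 2 := fun a =>
    lp.mapCLM 2 (fun _ : ι => a) (norm_nonneg a) fun _ => le_rfl
  have amp_apply : ∀ a ζ i, amp a ζ i = a (ζ i) := fun a ζ i => rfl
  have amp_inner : ∀ a ζ ζ', ⟪amp (star a) ζ, ζ'⟫_ℂ = ⟪ζ, amp a ζ'⟫_ℂ := by
    intro a ζ ζ'
    rw [lp.inner_eq_tsum, lp.inner_eq_tsum]
    exact tsum_congr fun i => ContinuousLinearMap.adjoint_inner_left _ _ _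
  let orbit : S →ₗ[ℂ] lp (fun _ : ι => K) 2 :=
    { toFun := fun s => amp s ξ
      map_add' := fun s t => by ext i; rfl
      map_smul' := fun c s => by ext i; rfl }
  let W : Submodule ℂ (lp (fun _ : ι => K) 2) := (LinearMap.range orbit).topologicalClosure
  have : CompleteSpace W :=
    (LinearMap.range orbit).isClosed_topologicalClosure.completeSpace_coe
  have hξ : ξ ∈ W := (LinearMap.range orbit).le_topologicalClosure ⟨⟨1, h1⟩, by ext i; rfl⟩
  have hη : η ∈ Wᗮ := by
    rw [Submodule.orthogonal_closure]
    rw [Submodule.mem_orthogonal']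
    rintro _ ⟨s, rfl⟩
    rw [lp.inner_eq_tsum]
    exact hS s s.2
  have hW : ∀ d ∈ D, ∀ ζ ∈ W, amp d ζ ∈ W := by
    intro d hd ζ hζ
    refine map_mem_closure (amp d).continuous hζ ?_
    rintro _ ⟨s, rfl⟩
    exact ⟨⟨d * s, hDS d hd s s.2⟩, by ext i; rfl⟩
  have hWo : ∀ d ∈ D, ∀ ζ ∈ Wᗮ, amp d ζ ∈ Wᗮ := by
    intro d hd ζ hζ
    rw [Submodule.mem_orthogonal] at hζ ⊢
    intro w hw
    rw [← amp_inner]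
    exact hζ _ (hW _ (hD d hd) w hw)
  let P : lp (fun _ : ι => K) 2 →L[ℂ] lp (fun _ : ι => K) 2 := W.starProjection
  have hP : ∀ d ∈ D, ∀ ζ, P (amp d ζ) = amp d (P ζ) := by
    intro d hd ζ
    refine Submodule.eq_starProjection_of_mem_orthogonal
      (hW d hd _ (W.starProjection_apply_mem ζ)) ?_
    rw [← map_sub]
    exact hWo d hd _ (W.sub_starProjection_mem_orthogonal ζ)
  let E : ι → K →L[ℂ] lp (fun _ : ι => K) 2 := fun j =>
    lp.singleContinuousLinearMap ℂ (fun _ : ι => K) 2 j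
  let Q : ι → lp (fun _ : ι => K) 2 →L[ℂ] K := fun i => lp.evalCLM ℂ (fun _ : ι => K) 2 i
  have hQ : ∀ i ζ, Q i ζ = ζ i := fun i ζ => rfl
  have hampE : ∀ a j v, amp a (E j v) = E j (a v) := by
    intro a j v
    ext i
    rw [amp_apply]
    by_cases h : i = j
    · subst h; simp [E]
    · simp [E, h]
  have hcomm : ∀ i j, (Q i ∘L P ∘L E j) * T = T * (Q i ∘L P ∘L E j) := by
    intro i j
    refine hT _ fun d hd => ?_
    ext v
    change d (Q i (P (E j v))) = Q i (P (E j (d v)))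
    rw [← hampE, hP d hd, hQ, hQ, amp_apply]
  have hPT : P (amp T ξ) = amp T (P ξ) := by
    ext i
    have hsum : ∀ ζ : lp (fun _ : ι => K) 2, HasSum (fun j => E j (ζ j)) ζ := fun ζ =>
      lp.hasSum_single (by simp) ζ
    have e1 := ((hsum (amp T ξ)).mapL P).mapL (Q i)
    have e2 := (((hsum ξ).mapL P).mapL (Q i)).mapL T
    refine e1.unique (e2.congr_fun fun j => ?_)
    exact DFunLike.congr_fun (hcomm i j) (ξ j)
  have hmem : amp T ξ ∈ W := by
    have : P ξ = ξ := Submodule.starProjection_eq_self_iff.2 hξ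
    rw [this] at hPT
    rw [← hPT]
    exact W.starProjection_apply_mem _
  have := (Submodule.mem_orthogonal' _ _).1 hη _ hmem
  rwa [lp.inner_eq_tsum] at this

end Operators

namespace VonNeumannAlgebra

variable {H : Type*} [NormedAddCommGroup H] [InnerProductSpace ℂ H] [CompleteSpace H]

theorem IsFaithfulNormalTracialState.isFaithfulTracialState {N : VonNeumannAlgebra H}
    {τ : N.Elem →ₗ[ℂ] ℂ} (hτ : N.IsFaithfulNormalTracialState τ) : IsFaithfulTracialState τ where
  nonneg := hτ.nonneg
  map_one := hτ.map_one
  trace := hτ.trace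
  faithful := hτ.faithful

theorem mem_of_commute_commutant {N : VonNeumannAlgebra H} {x : H →L[ℂ] H}
    (h : ∀ y ∈ N.commutant, y * x = x * y) : x ∈ N.toStarSubalgebra := by
  have e : N.commutant.commutant = N := commutant_commutant N
  refine (SetLike.ext_iff.1 e x).1 ?_
  rw [mem_commutant_iff]
  exact h

open Filter Topology in
/-- Weak compactness of balls, from the normality of the trace. -/
theorem IsFaithfulNormalTracialState.hasWeakUltralimits {N : VonNeumannAlgebra H}
    {τ : N.Elem →ₗ[ℂ] ℂ} (hτ : N.IsFaithfulNormalTracialState τ) : HasWeakUltralimits τ := by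
  intro x R hx
  obtain ⟨S, hS⟩ := exists_operator_ultralimit (T := fun n => (x n : H →L[ℂ] H)) hx
  have hSN : S ∈ N.toStarSubalgebra := mem_of_commute_commutant fun y hy => by
    refine ContinuousLinearMap.ext fun b => ext_inner_left ℂ fun a => ?_
    have h1 := hS (ContinuousLinearMap.adjoint y a) b
    have h2 := hS a (y b)
    simp only [ContinuousLinearMap.adjoint_inner_left] at h1
    refine tendsto_nhds_unique h1 (h2.congr fun n => ?_)
    have := DFunLike.congr_fun (mem_commutant_iff.1 hy _ (x n).2) b
    exact congrArg (fun z => ⟪a, z⟫_ℂ) this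
  refine ⟨⟨S, hSN⟩, fun w => ?_⟩
  obtain ⟨ξ, η, hξ, hη, hsum⟩ := hτ.normal
  have e : ∀ z : N.Elem, τ (w * z) = ∑' k, ⟪ContinuousLinearMap.adjoint (w : H →L[ℂ] H) (η k),
      (z : H →L[ℂ] H) (ξ k)⟫_ℂ := by
    intro z
    rw [← (hsum (w * z)).tsum_eq]
    exact tsum_congr fun k =>
      (ContinuousLinearMap.adjoint_inner_left (w : H →L[ℂ] H) ((z : H →L[ℂ] H) (ξ k)) (η k)).symm
  simp only [e]
  refine tendsto_tsum_of_dominated_convergence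
    (bound := fun k => ‖w‖ * R * (‖η k‖ * ‖ξ k‖)) ((summable_norm_mul_norm hξ hη).mul_left _)
    (fun k => hS _ _) (Eventually.of_forall fun n k => ?_)
  have h1 : ‖ContinuousLinearMap.adjoint (w : H →L[ℂ] H) (η k)‖ ≤ ‖w‖ * ‖η k‖ :=
    ContinuousLinearMap.le_of_opNorm_le _ (by
      rw [LinearIsometryEquiv.norm_map]; exact le_rfl) _
  have h2 : ‖(x n : H →L[ℂ] H) (ξ k)‖ ≤ R * ‖ξ k‖ := ContinuousLinearMap.le_of_opNorm_le _ (hx n) _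
  calc _ ≤ _ := norm_inner_le_norm _ _
    _ ≤ ‖w‖ * ‖η k‖ * (R * ‖ξ k‖) := by gcongr
    _ = _ := by ring

end VonNeumannAlgebra

section NormalFunctionals

theorem summable_norm_sq_map {H K : Type*} [NormedAddCommGroup H] [NormedSpace ℂ H]
    [NormedAddCommGroup K] [NormedSpace ℂ K] (B : H →L[ℂ] K) {ξ : ℕ → H}
    (hξ : Summable fun n => ‖ξ n‖ ^ 2) :
    Summable fun n => ‖B (ξ n)‖ ^ 2 := by
  refine Summable.of_nonneg_of_le (fun n => by positivity) (fun n => ?_) (hξ.mul_left (‖B‖ ^ 2))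
  rw [← mul_pow]
  exact pow_le_pow_left₀ (norm_nonneg _) (B.le_opNorm _) 2

/-- Two normal functionals on the bicommutant of a unital self-adjoint set `D` of operators, given
by pairs of sequences of vectors, coincide as soon as they coincide on a unital subspace stable
under multiplication by `D`. -/
theorem tsum_inner_eq_of_mem_bicommutant {K : Type*} [NormedAddCommGroup K]
    [InnerProductSpace ℂ K] [CompleteSpace K] {D : Set (K →L[ℂ] K)} (hD : ∀ d ∈ D, star d ∈ D)
    (S : Submodule ℂ (K →L[ℂ] K)) (h1 : 1 ∈ S) (hDS : ∀ d ∈ D, ∀ s ∈ S, d * s ∈ S)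
    {T : K →L[ℂ] K} (hT : ∀ P : K →L[ℂ] K, (∀ d ∈ D, d * P = P * d) → P * T = T * P)
    {ξ η ξ' η' : ℕ → K} (hξ : Summable fun n => ‖ξ n‖ ^ 2) (hη : Summable fun n => ‖η n‖ ^ 2)
    (hξ' : Summable fun n => ‖ξ' n‖ ^ 2) (hη' : Summable fun n => ‖η' n‖ ^ 2)
    (hS : ∀ s ∈ S, ∑' n, ⟪η n, s (ξ n)⟫_ℂ = ∑' n, ⟪η' n, s (ξ' n)⟫_ℂ) :
    ∑' n, ⟪η n, T (ξ n)⟫_ℂ = ∑' n, ⟪η' n, T (ξ' n)⟫_ℂ := by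
  have mem : ∀ {f g : ℕ → K}, Summable (fun n => ‖f n‖ ^ 2) → Summable (fun n => ‖g n‖ ^ 2) →
      Memℓp (Sum.elim f g) 2 := by
    intro f g hf hg
    refine memℓp_gen ?_
    simp only [ENNReal.toReal_ofNat, Real.rpow_ofNat]
    exact (HasSum.sum (f := fun i => ‖Sum.elim f g i‖ ^ 2) hf.hasSum hg.hasSum).summable
  let Ξ : lp (fun _ : ℕ ⊕ ℕ => K) 2 := ⟨Sum.elim ξ ξ', mem hξ hξ'⟩
  let Η : lp (fun _ : ℕ ⊕ ℕ => K) 2 := ⟨Sum.elim η fun n => -η' n, mem hη (by simpa using hη')⟩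
  have hsum : ∀ (a : K →L[ℂ] K) {f g : ℕ → K}, Summable (fun n => ‖f n‖ ^ 2) →
      Summable (fun n => ‖g n‖ ^ 2) → Summable fun n => ⟪g n, a (f n)⟫_ℂ := by
    intro a f g hf hg
    refine Summable.of_norm_bounded (summable_norm_mul_norm (summable_norm_sq_map a hf) hg)
      fun n => norm_inner_le_norm _ _
  have split : ∀ a : K →L[ℂ] K, ∑' i, ⟪Η i, a (Ξ i)⟫_ℂ =
      ∑' n, ⟪η n, a (ξ n)⟫_ℂ - ∑' n, ⟪η' n, a (ξ' n)⟫_ℂ := by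
    intro a
    have h2 : HasSum (fun n => ⟪-η' n, a (ξ' n)⟫_ℂ) (-∑' n, ⟪η' n, a (ξ' n)⟫_ℂ) := by
      simpa only [inner_neg_left] using (hsum a hξ' hη').hasSum.neg
    rw [sub_eq_add_neg]
    exact (HasSum.sum (f := fun i => ⟪Η i, a (Ξ i)⟫_ℂ) (hsum a hξ hη).hasSum h2).tsum_eq
  have h := tsum_inner_eq_zero_of_mem_bicommutant hD S h1 hDS hT Ξ Η fun s hs => by
    rw [split, hS s hs, sub_self]
  rw [split] at h
  exact sub_eq_zero.1 h

end NormalFunctionals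

/-! ### Fourier expansion in the crossed product -/

namespace VonNeumannAlgebra

variable {H : Type*} [NormedAddCommGroup H] [InnerProductSpace ℂ H] [CompleteSpace H]
  {G : Type*} [Group G] [Fintype G]

/-- The conditional expectation of `N ⋊_α G` onto `N`, as an `N`-valued map: `∑ x_g v_g ↦ x_1`. -/
noncomputable def crossedExpectation (N : VonNeumannAlgebra H)
    (α : G →* (N.Elem ≃⋆ₐ[ℂ] N.Elem)) : (crossedProduct N α).Elem →ₗ[ℂ] N.Elem where
  toFun T := ⟨unitEntry (T : PiLp 2 (fun _ : G => H) →L[ℂ] PiLp 2 (fun _ : G => H)),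
    unitEntry_mem N α T⟩
  map_add' S T := Subtype.ext (by ext ξ; simp [unitEntry])
  map_smul' c T := Subtype.ext (by ext ξ; simp [unitEntry])

open scoped Classical in
theorem adjoint_proj_apply (h : H) (s : G) :
    ContinuousLinearMap.adjoint (PiLp.proj (𝕜 := ℂ) 2 (fun _ : G => H) (1 : G)) h s =
      if s = 1 then h else 0 := by
  have : ContinuousLinearMap.adjoint (PiLp.proj (𝕜 := ℂ) 2 (fun _ : G => H) (1 : G)) h =
      PiLp.single 2 1 h := by
    refine ext_inner_left ℂ fun ζ => ?_
    rw [ContinuousLinearMap.adjoint_inner_right, PiLp.inner_apply,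
      Finset.sum_eq_single (1 : G) (fun t _ ht => by simp [ht]) (by simp)]
    simp
  rw [this, PiLp.single_apply]

variable (N : VonNeumannAlgebra H) (α : G →* (N.Elem ≃⋆ₐ[ℂ] N.Elem))

theorem crossedExpectation_apply (T : (crossedProduct N α).Elem) (h : H) :
    (crossedExpectation N α T : H →L[ℂ] H) h =
      (T : PiLp 2 (fun _ : G => H) →L[ℂ] PiLp 2 (fun _ : G => H))
        (ContinuousLinearMap.adjoint (PiLp.proj (𝕜 := ℂ) 2 (fun _ : G => H) (1 : G)) h) 1 := rfl

theorem crossedExpectation_star (T : (crossedProduct N α).Elem) :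
    crossedExpectation N α (star T) = star (crossedExpectation N α T) := by
  refine Subtype.ext ?_
  change unitEntry _ = star (unitEntry _)
  rw [unitEntry, unitEntry, ContinuousLinearMap.star_eq_adjoint, ContinuousLinearMap.adjoint_comp,
    ContinuousLinearMap.adjoint_comp, ContinuousLinearMap.adjoint_adjoint]
  rfl

theorem crossedExpectation_embedding_mul (x : N.Elem) (T : (crossedProduct N α).Elem) :
    crossedExpectation N α (crossedEmbedding N α x * T) = x * crossedExpectation N α T := by
  refine Subtype.ext (ContinuousLinearMap.ext fun h => ?_)
  change crossedRep N α x _ 1 = (x : H →L[ℂ] H) _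
  rw [crossedRep_apply, inv_one, map_one]
  rfl

open scoped Classical in
theorem crossedExpectation_unitary (g : G) :
    crossedExpectation N α (crossedUnitary N α g : (crossedProduct N α).Elem) =
      if g = 1 then 1 else 0 := by
  refine Subtype.ext (ContinuousLinearMap.ext fun h => ?_)
  rw [crossedExpectation_apply]
  change crossedShift H g _ 1 = _
  rw [crossedShift_apply, adjoint_proj_apply]
  by_cases hg : g = 1 <;> simp [hg]

theorem crossedUnitary_mul_embedding (g : G) (x : N.Elem) :
    (crossedUnitary N α g : (crossedProduct N α).Elem) * crossedEmbedding N α x =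
      crossedEmbedding N α (α g x) * (crossedUnitary N α g : (crossedProduct N α).Elem) := by
  refine Subtype.ext (ContinuousLinearMap.ext fun ξ => PiLp.ext fun s => ?_)
  change crossedShift H g (crossedRep N α x ξ) s = crossedRep N α (α g x) (crossedShift H g ξ) s
  rw [crossedShift_apply, crossedRep_apply, crossedRep_apply, crossedShift_apply, mul_inv_rev,
    inv_inv, map_mul]
  rfl

theorem coe_crossedUnitary_mul (g h : G) :
    (crossedUnitary N α (g * h) : (crossedProduct N α).Elem) =
      (crossedUnitary N α g : (crossedProduct N α).Elem) * crossedUnitary N α h := by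
  rw [map_mul]; rfl

/-- The subspace of finite sums `∑ x_g v_g`. -/
noncomputable def crossedSums : Submodule ℂ (crossedProduct N α).Elem :=
  Submodule.span ℂ {R | ∃ x g, R = crossedEmbedding N α x *
    (crossedUnitary N α g : (crossedProduct N α).Elem)}

variable {N α}

theorem one_mem_crossedSums : (1 : (crossedProduct N α).Elem) ∈ crossedSums N α :=
  Submodule.subset_span ⟨1, 1, by rw [map_one, map_one, one_mul]; rfl⟩

theorem mul_mem_crossedSums {d R : (crossedProduct N α).Elem} (hR : R ∈ crossedSums N α)
    (hd : ∀ x g, d * (crossedEmbedding N α x * (crossedUnitary N α g : (crossedProduct N α).Elem)) ∈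
      crossedSums N α) : d * R ∈ crossedSums N α := by
  refine Submodule.span_induction (p := fun R _ => d * R ∈ crossedSums N α) ?_ ?_ ?_ ?_ hR
  · rintro _ ⟨x, g, rfl⟩
    exact hd x g
  · rw [mul_zero]; exact zero_mem _
  · intro a b _ _ iha ihb
    rw [mul_add]; exact add_mem iha ihb
  · intro c a _ iha
    rw [mul_smul_comm]; exact Submodule.smul_mem _ c iha

theorem embedding_mul_mem_crossedSums (y : N.Elem) {R : (crossedProduct N α).Elem}
    (hR : R ∈ crossedSums N α) : crossedEmbedding N α y * R ∈ crossedSums N α :=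
  mul_mem_crossedSums hR fun x g => Submodule.subset_span
    ⟨y * x, g, by rw [map_mul, mul_assoc]⟩

theorem unitary_mul_mem_crossedSums (k : G) {R : (crossedProduct N α).Elem}
    (hR : R ∈ crossedSums N α) :
    (crossedUnitary N α k : (crossedProduct N α).Elem) * R ∈ crossedSums N α :=
  mul_mem_crossedSums hR fun x g => Submodule.subset_span
    ⟨α k x, k * g, by
      rw [← mul_assoc, crossedUnitary_mul_embedding, coe_crossedUnitary_mul, mul_assoc]⟩

/-- The equivariance `E(v_g R v_g⋆) = α_g(E(R))` on the finite sums, where it is immediate from the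
relations; `crossedExpectation_conj` carries it over to the bicommutant. -/
theorem crossedExpectation_conj_of_mem_crossedSums (g : G) {R : (crossedProduct N α).Elem}
    (hR : R ∈ crossedSums N α) :
    crossedExpectation N α ((crossedUnitary N α g : (crossedProduct N α).Elem) * R *
      (crossedUnitary N α g⁻¹ : (crossedProduct N α).Elem)) = α g (crossedExpectation N α R) := by
  classical
  refine LinearMap.eqOn_span (R := ℂ)
    (f := crossedExpectation N α ∘ₗ
      LinearMap.mulRight ℂ (crossedUnitary N α g⁻¹ : (crossedProduct N α).Elem) ∘ₗ
      LinearMap.mulLeft ℂ (crossedUnitary N α g : (crossedProduct N α).Elem))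
    (g := ((α g).toAlgEquiv : N.Elem →ₐ[ℂ] N.Elem).toLinearMap ∘ₗ crossedExpectation N α) ?_ hR
  rintro _ ⟨x, h, rfl⟩
  change crossedExpectation N α ((crossedUnitary N α g : (crossedProduct N α).Elem) *
    (crossedEmbedding N α x * (crossedUnitary N α h : (crossedProduct N α).Elem)) *
      (crossedUnitary N α g⁻¹ : (crossedProduct N α).Elem)) = α g (crossedExpectation N α _)
  rw [← mul_assoc, crossedUnitary_mul_embedding, mul_assoc, mul_assoc,
    crossedExpectation_embedding_mul, ← coe_crossedUnitary_mul, ← coe_crossedUnitary_mul,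
    crossedExpectation_embedding_mul, crossedExpectation_unitary, crossedExpectation_unitary,
    map_mul]
  have : g * (h * g⁻¹) = 1 ↔ h = 1 := by
    rw [← mul_assoc, mul_inv_eq_one, mul_eq_left]
  by_cases hh : h = 1 <;> simp [hh, this]

/-- The expectation onto `N` is equivariant. Both sides are normal in `T`, and they coincide on
the finite sums `∑ x_g v_g`. -/
theorem crossedExpectation_conj {τ : N.Elem →ₗ[ℂ] ℂ} (hτ : N.IsFaithfulNormalTracialState τ)
    (hinv : ∀ g x, τ (α g x) = τ x) (g : G) (T : (crossedProduct N α).Elem) :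
    crossedExpectation N α ((crossedUnitary N α g : (crossedProduct N α).Elem) * T *
      (crossedUnitary N α g⁻¹ : (crossedProduct N α).Elem)) = α g (crossedExpectation N α T) := by
  classical
  refine hτ.isFaithfulTracialState.eq_of_forall_mul fun w => ?_
  have hrw : ∀ y : N.Elem, τ (w * α g y) = τ (α g⁻¹ w * y) := by
    intro y
    rw [← hinv g (α g⁻¹ w * y), map_mul (α g), ← StarAlgEquiv.mul_apply, ← map_mul α,
      mul_inv_cancel, map_one]
    rfl
  rw [hrw]
  obtain ⟨ξ, η, hξ, hη, hsum⟩ := hτ.normal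
  let P : PiLp 2 (fun _ : G => H) →L[ℂ] H := PiLp.proj (𝕜 := ℂ) 2 (fun _ : G => H) (1 : G)
  let J : H →L[ℂ] PiLp 2 (fun _ : G => H) := ContinuousLinearMap.adjoint P
  have hform : ∀ (A : PiLp 2 (fun _ : G => H) →L[ℂ] H) (B : H →L[ℂ] PiLp 2 (fun _ : G => H))
      (R : PiLp 2 (fun _ : G => H) →L[ℂ] PiLp 2 (fun _ : G => H)) (y : N.Elem),
      (y : H →L[ℂ] H) = A ∘L R ∘L B →
      τ y = ∑' n, ⟪ContinuousLinearMap.adjoint A (η n), R (B (ξ n))⟫_ℂ := by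
    intro A B R y hy
    rw [← (hsum y).tsum_eq]
    refine tsum_congr fun n => ?_
    rw [hy, ContinuousLinearMap.adjoint_inner_left]
    rfl
  let A₁ : PiLp 2 (fun _ : G => H) →L[ℂ] H := (w : H →L[ℂ] H) ∘L P ∘L crossedShift H g
  let B₁ : H →L[ℂ] PiLp 2 (fun _ : G => H) := crossedShift H g⁻¹ ∘L J
  let A₂ : PiLp 2 (fun _ : G => H) →L[ℂ] H := ((α g⁻¹ w : N.Elem) : H →L[ℂ] H) ∘L P
  have h₁ : ∀ R : (crossedProduct N α).Elem, τ (w * crossedExpectation N α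
      ((crossedUnitary N α g : (crossedProduct N α).Elem) * R *
        (crossedUnitary N α g⁻¹ : (crossedProduct N α).Elem))) =
      ∑' n, ⟪ContinuousLinearMap.adjoint A₁ (η n), (R : PiLp 2 (fun _ : G => H) →L[ℂ]
        PiLp 2 (fun _ : G => H)) (B₁ (ξ n))⟫_ℂ := fun R => hform A₁ B₁ R _ rfl
  have h₂ : ∀ R : (crossedProduct N α).Elem, τ (α g⁻¹ w * crossedExpectation N α R) =
      ∑' n, ⟪ContinuousLinearMap.adjoint A₂ (η n), (R : PiLp 2 (fun _ : G => H) →L[ℂ]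
        PiLp 2 (fun _ : G => H)) (J (ξ n))⟫_ℂ := fun R => hform A₂ J R _ rfl
  rw [h₁, h₂]
  let val : (crossedProduct N α).Elem →ₗ[ℂ]
      (PiLp 2 (fun _ : G => H) →L[ℂ] PiLp 2 (fun _ : G => H)) :=
    { toFun := fun R => R, map_add' := fun _ _ => rfl, map_smul' := fun _ _ => rfl }
  let D : Set (PiLp 2 (fun _ : G => H) →L[ℂ] PiLp 2 (fun _ : G => H)) :=
    Set.range (crossedRep N α) ∪ Set.range (crossedShift (G := G) H)
  have hD : ∀ d ∈ D, star d ∈ D := by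
    rintro d (⟨x, rfl⟩ | ⟨h, rfl⟩)
    · exact Or.inl ⟨star x, crossedRep_star N α x⟩
    · exact Or.inr ⟨h⁻¹, (crossedShift_star h).symm⟩
  refine tsum_inner_eq_of_mem_bicommutant hD ((crossedSums N α).map val) ?_ ?_ ?_
    (summable_norm_sq_map B₁ hξ) (summable_norm_sq_map _ hη) (summable_norm_sq_map J hξ)
    (summable_norm_sq_map _ hη) ?_
  · exact ⟨1, one_mem_crossedSums, rfl⟩
  · rintro d (⟨y, rfl⟩ | ⟨k, rfl⟩) _ ⟨R, hR, rfl⟩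
    · exact ⟨crossedEmbedding N α y * R, embedding_mul_mem_crossedSums y hR, rfl⟩
    · exact ⟨(crossedUnitary N α k : (crossedProduct N α).Elem) * R,
        unitary_mul_mem_crossedSums k hR, rfl⟩
  · intro Q hQ
    have hQmem : Q ∈ StarSubalgebra.centralizer ℂ D := by
      rw [StarSubalgebra.mem_centralizer_iff]
      exact fun d hd => ⟨hQ d hd, hQ _ (hD d hd)⟩
    exact ((StarSubalgebra.mem_centralizer_iff ℂ).1 T.2 Q hQmem).1
  · rintro _ ⟨R, hR, rfl⟩
    refine (h₁ R).symm.trans (Eq.trans ?_ (h₂ R))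
    rw [← hrw, crossedExpectation_conj_of_mem_crossedSums g hR]

/-- A vector of `ℓ²(G, H)` is the sum of its coordinates, each moved from the coordinate `1` to its
place by the shift: the translates of the corner that `E` reads off exhaust the space. -/
theorem sum_crossedShift_adjoint_proj (ξ : PiLp 2 (fun _ : G => H)) :
    ξ = ∑ t, crossedShift H t
      (ContinuousLinearMap.adjoint (PiLp.proj (𝕜 := ℂ) 2 (fun _ : G => H) (1 : G)) (ξ t)) := by
  classical
  refine PiLp.ext fun s => ?_
  rw [WithLp.ofLp_sum, Finset.sum_apply, Finset.sum_eq_single s]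
  · rw [crossedShift_apply, adjoint_proj_apply, inv_mul_cancel, if_pos rfl]
  · intro t _ ht
    rw [crossedShift_apply, adjoint_proj_apply, if_neg]
    rw [inv_mul_eq_one]
    exact ht
  · simp

/-- By equivariance of the expectation, an element is determined by its Fourier coefficients
`E(T v_h)`. -/
theorem eq_zero_of_crossedExpectation_mul {τ : N.Elem →ₗ[ℂ] ℂ}
    (hτ : N.IsFaithfulNormalTracialState τ) (hinv : ∀ g x, τ (α g x) = τ x)
    {T : (crossedProduct N α).Elem}
    (hT : ∀ h,
      crossedExpectation N α (T * (crossedUnitary N α h : (crossedProduct N α).Elem)) = 0) :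
    T = 0 := by
  have hst : ∀ s t, crossedExpectation N α ((crossedUnitary N α s⁻¹ : (crossedProduct N α).Elem) *
      T * (crossedUnitary N α t : (crossedProduct N α).Elem)) = 0 := by
    intro s t
    have h := crossedExpectation_conj hτ hinv s⁻¹
      (T * (crossedUnitary N α (t * s⁻¹) : (crossedProduct N α).Elem))
    rw [hT, map_zero, inv_inv, mul_assoc, mul_assoc, ← coe_crossedUnitary_mul, mul_assoc,
      inv_mul_cancel, mul_one, ← mul_assoc] at h
    exact h
  refine Subtype.ext (ContinuousLinearMap.ext fun ξ => PiLp.ext fun s => ?_)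
  conv_lhs => rw [sum_crossedShift_adjoint_proj ξ]
  rw [map_sum, WithLp.ofLp_sum, Finset.sum_apply]
  refine Finset.sum_eq_zero fun t _ => ?_
  have h := congrArg (fun z : N.Elem => (z : H →L[ℂ] H) (ξ t)) (hst s t)
  simp only [crossedExpectation_apply] at h
  change crossedShift H s⁻¹ _ 1 = 0 at h
  rw [crossedShift_apply, inv_inv, mul_one] at h
  exact h

theorem crossedExpectation_sum_mul (c : G → N.Elem) (h : G) :
    crossedExpectation N α
      ((∑ g, crossedEmbedding N α (c g) * (crossedUnitary N α g : (crossedProduct N α).Elem)) *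
        (crossedUnitary N α h⁻¹ : (crossedProduct N α).Elem)) = c h := by
  classical
  rw [Finset.sum_mul, map_sum, Finset.sum_eq_single h]
  · rw [mul_assoc, ← coe_crossedUnitary_mul, crossedExpectation_embedding_mul,
      crossedExpectation_unitary, mul_inv_cancel, if_pos rfl, mul_one]
  · intro g _ hg
    rw [mul_assoc, ← coe_crossedUnitary_mul, crossedExpectation_embedding_mul,
      crossedExpectation_unitary, if_neg (by rwa [mul_inv_eq_one]), mul_zero]
  · simp

/-- Every element of the crossed product is the finite sum `∑ E(T v_g⋆) v_g`. -/
theorem eq_sum_crossedExpectation {τ : N.Elem →ₗ[ℂ] ℂ} (hτ : N.IsFaithfulNormalTracialState τ)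
    (hinv : ∀ g x, τ (α g x) = τ x) (T : (crossedProduct N α).Elem) :
    T = ∑ g, crossedEmbedding N α
        (crossedExpectation N α (T * (crossedUnitary N α g⁻¹ : (crossedProduct N α).Elem))) *
      (crossedUnitary N α g : (crossedProduct N α).Elem) := by
  refine sub_eq_zero.1 (eq_zero_of_crossedExpectation_mul hτ hinv fun h => ?_)
  obtain ⟨k, rfl⟩ : ∃ k, h = k⁻¹ := ⟨h⁻¹, (inv_inv h).symm⟩
  rw [sub_mul, map_sub, crossedExpectation_sum_mul, sub_self]

end VonNeumannAlgebra

/-! ### Trace, expectations and entropy in the crossed product -/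

/-- The algebraic data of a crossed product of `A` by a finite group: an embedding `π`, unitaries
`v_g` implementing `α`, and an equivariant `A`-bimodule expectation `E` that reads off the
coefficient of `v_1`, such that every `T` is the sum of its Fourier series `∑ E(T v_g⋆) v_g`. -/
structure IsCrossedSystem {A M G : Type*} [CStarAlgebra A] [CStarAlgebra M] [Group G] [Fintype G]
    (α : G →* (A ≃⋆ₐ[ℂ] A)) (π : A →⋆ₐ[ℂ] M) (v : G →* unitary M) (E : M →ₗ[ℂ] A) : Prop where
  unitary_mul : ∀ g x, (v g : M) * π x = π (α g x) * (v g : M)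
  expectation_star : ∀ T, E (star T) = star (E T)
  embedding_mul : ∀ x T, E (π x * T) = x * E T
  map_unitary_one : E (v 1 : M) = 1
  map_unitary : ∀ g, g ≠ 1 → E (v g : M) = 0
  conj : ∀ g T, E ((v g : M) * T * (v g⁻¹ : M)) = α g (E T)
  expansion : ∀ T, T = ∑ g, π (E (T * (v g⁻¹ : M))) * (v g : M)

theorem condExpectation_eq {M : Type*} [CStarAlgebra M] {σ : M →ₗ[ℂ] ℂ}
    (hσ : IsFaithfulTracialState σ) {B : StarSubalgebra ℂ M} {x y : M} (hy : y ∈ B)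
    (h : ∀ b ∈ B, σ (y * b) = σ (x * b)) : condExpectation σ B x = y := by
  have hex : ∃ y ∈ B, ∀ b ∈ B, σ (y * b) = σ (x * b) := ⟨y, hy, h⟩
  rw [condExpectation, dif_pos hex]
  obtain ⟨h1, h2⟩ := hex.choose_spec
  set z := hex.choose
  have h3 : star (z - y) ∈ B := star_mem (sub_mem h1 hy)
  have h4 : σ (star (z - y) * (z - y)) = 0 := by
    rw [hσ.trace, sub_mul, map_sub, h2 _ h3, h _ h3, sub_self]
  exact sub_eq_zero.1 (hσ.faithful _ h4)

theorem sum_negMulLog_le_log_card {ι : Type*} [Fintype ι] [Nonempty ι] {p : ι → ℝ}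
    (hp : ∀ i, 0 ≤ p i) (hsum : ∑ i, p i = 1) :
    ∑ i, Real.negMulLog (p i) ≤ Real.log (Fintype.card ι) := by
  have hn : (0 : ℝ) < Fintype.card ι := by exact_mod_cast Fintype.card_pos
  have h := Real.concaveOn_negMulLog.le_map_sum (t := Finset.univ)
    (w := fun _ : ι => (Fintype.card ι : ℝ)⁻¹) (p := p) (fun _ _ => by positivity)
    (by rw [Finset.sum_const, Finset.card_univ, nsmul_eq_mul, mul_inv_cancel₀ hn.ne'])
    (fun i _ => hp i)
  simp only [smul_eq_mul, ← Finset.mul_sum, hsum, mul_one] at h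
  rw [Real.negMulLog, Real.log_inv, inv_mul_le_iff₀ hn] at h
  refine h.trans_eq ?_
  field_simp

namespace IsCrossedSystem

section Unitaries

variable {M G : Type*} [CStarAlgebra M] [Group G]

theorem coe_inv (v : G →* unitary M) (g : G) : (v g⁻¹ : M) = star (v g : M) := by
  rw [map_inv]; rfl

theorem coe_mul (v : G →* unitary M) (g h : G) : (v (g * h) : M) = (v g : M) * (v h : M) := by
  rw [map_mul]; rfl

theorem coe_inv_mul (v : G →* unitary M) (g : G) : (v g⁻¹ : M) * (v g : M) = 1 := by
  rw [← coe_mul, inv_mul_cancel, map_one]; rfl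

theorem coe_mul_inv (v : G →* unitary M) (g : G) : (v g : M) * (v g⁻¹ : M) = 1 := by
  rw [← coe_mul, mul_inv_cancel, map_one]; rfl

end Unitaries

variable {A M G : Type*} [CStarAlgebra A] [CStarAlgebra M] [Group G] [Fintype G]
  {α : G →* (A ≃⋆ₐ[ℂ] A)} {π : A →⋆ₐ[ℂ] M} {v : G →* unitary M} {E : M →ₗ[ℂ] A}

variable (h : IsCrossedSystem α π v E)
include h

theorem mul_embedding (T : M) (x : A) : E (T * π x) = E T * x := by
  rw [← star_inj, ← h.expectation_star, star_mul, star_mul, ← map_star π, h.embedding_mul,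
    h.expectation_star]

theorem map_one : E 1 = 1 := by
  have := h.map_unitary_one
  rwa [_root_.map_one] at this

theorem map_embedding (x : A) : E (π x) = x := by
  rw [← mul_one (π x), h.embedding_mul, h.map_one, mul_one]

/-- The Fourier coefficients `E(T v_g⋆)`, by uniqueness of the expansion. -/
theorem coeff_eq {T : M} {c : G → A} (hT : T = ∑ g, π (c g) * (v g : M)) (k : G) :
    E (T * (v k⁻¹ : M)) = c k := by
  classical
  rw [hT, Finset.sum_mul, map_sum, Finset.sum_eq_single k]
  · rw [mul_assoc, coe_mul_inv, mul_one, h.map_embedding]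
  · intro g _ hg
    rw [mul_assoc, ← coe_mul, h.embedding_mul, h.map_unitary _ (by rwa [ne_eq, mul_inv_eq_one]),
      mul_zero]
  · simp

theorem expectation_mul_star {T : M} {c : G → A} (hT : T = ∑ g, π (c g) * (v g : M)) :
    E (T * star T) = ∑ g, c g * star (c g) := by
  have e : T * star T = ∑ g, T * (v g⁻¹ : M) * π (star (c g)) := by
    nth_rewrite 2 [hT]
    rw [star_sum, Finset.mul_sum]
    refine Finset.sum_congr rfl fun g _ => ?_
    rw [star_mul, coe_inv, map_star, mul_assoc]
  rw [e, map_sum]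
  refine Finset.sum_congr rfl fun g _ => ?_
  rw [h.mul_embedding, h.coeff_eq hT]

theorem expectation_star_mul_mul {T : M} {c : G → A} (hT : T = ∑ g, π (c g) * (v g : M)) (a : A) :
    E (star T * π a * T) = ∑ g, α g⁻¹ (star (c g) * a * c g) := by
  have e : star T * π a * T = ∑ g, (v g⁻¹ : M) * (π (star (c g) * a) * (T * (v g⁻¹ : M))) *
      (v g⁻¹⁻¹ : M) := by
    nth_rewrite 1 [hT]
    rw [star_sum, Finset.sum_mul, Finset.sum_mul]
    refine Finset.sum_congr rfl fun g _ => ?_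
    rw [star_mul, ← coe_inv, ← map_star, map_mul π]
    simp only [mul_assoc]
    rw [coe_mul_inv, mul_one]
  rw [e, map_sum]
  refine Finset.sum_congr rfl fun g _ => ?_
  rw [h.conj, h.embedding_mul, h.coeff_eq hT]

/-- The expectation of `y⋆ y` has the form `z⋆ z`. -/
theorem expectation_star_mul_self (y : M) : ∃ z, E (star y * y) = star z * z := by
  have h1 := h.expectation_star_mul_mul (h.expansion y) 1
  rw [_root_.map_one, mul_one] at h1
  obtain ⟨z, hz⟩ := IsFaithfulTracialState.exists_star_mul_self_of_sum Finset.univ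
    fun g => α g⁻¹ (E (y * (v g⁻¹ : M)))
  refine ⟨z, ?_⟩
  rw [h1, ← hz]
  refine Finset.sum_congr rfl fun g _ => ?_
  rw [mul_one, map_mul, map_star]

variable {τ : A →ₗ[ℂ] ℂ}

theorem sum_negMulLog_le (hτ : IsFaithfulTracialState τ) {u : unitary M} {c : G → A}
    (hu : (u : M) = ∑ g, π (c g) * (v g : M)) :
    ∑ g, Real.negMulLog (τ (c g * star (c g))).re ≤ Real.log (Fintype.card G) := by
  refine sum_negMulLog_le_log_card (fun g => ?_) ?_
  · rw [hτ.trace]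
    exact hτ.re_star_mul_self _
  · rw [← Complex.re_sum, ← map_sum, ← h.expectation_mul_star hu, Unitary.mul_star_self_of_mem u.2,
      h.map_one, hτ.re_one]

variable (hτ : IsFaithfulTracialState τ) (hinv : ∀ g x, τ (α g x) = τ x)
include hτ hinv

theorem isFaithfulTracialState_comp : IsFaithfulTracialState (τ ∘ₗ E) where
  nonneg T := by
    have h1 := h.expectation_star_mul_mul (h.expansion T) 1
    rw [_root_.map_one, mul_one] at h1
    rw [LinearMap.comp_apply, h1, map_sum]
    refine Finset.sum_nonneg fun g _ => ?_
    rw [hinv, mul_one]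
    exact hτ.nonneg _
  map_one := by rw [LinearMap.comp_apply, h.map_one, hτ.map_one]
  trace S T := by
    rw [LinearMap.comp_apply, LinearMap.comp_apply, h.expansion S, Finset.sum_mul, Finset.mul_sum,
      map_sum, map_sum, map_sum, map_sum]
    refine Finset.sum_congr rfl fun g _ => ?_
    set x := E (S * (v g⁻¹ : M))
    have e : T * (π x * (v g : M)) = (v g⁻¹ : M) * ((v g : M) * T * π x) * (v g⁻¹⁻¹ : M) := by
      rw [inv_inv]
      simp only [← mul_assoc]
      rw [coe_inv_mul, one_mul]
    rw [mul_assoc, h.embedding_mul, e, h.conj, hinv, h.mul_embedding, hτ.trace]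
  faithful T hT := by
    have h1 := h.expectation_star_mul_mul (h.expansion T) 1
    rw [_root_.map_one, mul_one] at h1
    rw [LinearMap.comp_apply, h1, map_sum] at hT
    simp only [hinv, mul_one] at hT
    have h2 := (Finset.sum_eq_zero_iff_of_nonneg fun g _ => hτ.nonneg _).1 hT
    rw [h.expansion T]
    refine Finset.sum_eq_zero fun g hg => ?_
    rw [hτ.faithful _ (h2 g hg), map_zero, zero_mul]

theorem condExpectation_range (T : M) : condExpectation (τ ∘ₗ E) π.range T = π (E T) := by
  refine condExpectation_eq (h.isFaithfulTracialState_comp hτ hinv) ⟨E T, rfl⟩ ?_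
  rintro _ ⟨a, rfl⟩
  change τ (E (π (E T) * π a)) = τ (E (T * π a))
  rw [h.mul_embedding, h.mul_embedding, h.map_embedding]

theorem condExpectation_conj_range (u : unitary M) (T : M) :
    condExpectation (τ ∘ₗ E) (π.range.map (Unitary.conjStarAlgAut ℂ M u : M →⋆ₐ[ℂ] M)) T =
      Unitary.conjStarAlgAut ℂ M u (π (E (star (u : M) * T * u))) := by
  have hσ := h.isFaithfulTracialState_comp hτ hinv
  refine condExpectation_eq hσ ⟨π (E (star (u : M) * T * u)), ⟨_, rfl⟩, rfl⟩ ?_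
  rintro _ ⟨_, ⟨a, rfl⟩, rfl⟩
  change (τ ∘ₗ E) (Unitary.conjStarAlgAut ℂ M u (π (E (star (u : M) * T * u))) *
    Unitary.conjStarAlgAut ℂ M u (π a)) = (τ ∘ₗ E) (T * Unitary.conjStarAlgAut ℂ M u (π a))
  have hu : star (u : M) * u = 1 := Unitary.star_mul_self_of_mem u.2
  have e : (τ ∘ₗ E) (T * (u * π a * star (u : M))) = (τ ∘ₗ E) (star (u : M) * T * u * π a) := by
    rw [← mul_assoc, hσ.trace, ← mul_assoc, ← mul_assoc]
  rw [← map_mul, Unitary.conjStarAlgAut_apply, Unitary.conjStarAlgAut_apply, e, hσ.trace,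
    ← mul_assoc, hu, one_mul]
  change τ (E (π (E (star (u : M) * T * u)) * π a)) = τ (E (star (u : M) * T * u * π a))
  rw [h.mul_embedding, h.mul_embedding, h.map_embedding]

/-- The bound on the conditional relative entropy of `A` with respect to `u A u⋆`. -/
theorem condRelEntropy_le {u : unitary M} {c : G → A} (hu : (u : M) = ∑ g, π (c g) * (v g : M)) :
    condRelEntropy (τ ∘ₗ E) π.range (π.range.map (Unitary.conjStarAlgAut ℂ M u : M →⋆ₐ[ℂ] M)) ≤
      ((∑ g, Real.negMulLog (τ (c g * star (c g))).re : ℝ) : EReal) := by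
  have hσ := h.isFaithfulTracialState_comp hτ hinv
  refine iSup_le fun n => iSup_le fun x => iSup_le fun hx => iSup_le fun hsum => ?_
  rw [EReal.coe_le_coe_iff]
  have ha : ∀ i, ∃ z, E (x i) = star z * z := fun i => by
    obtain ⟨y, hy⟩ := hx i
    rw [hy]
    exact h.expectation_star_mul_self y
  have hasum : ∑ i, E (x i) = 1 := by rw [← map_sum, hsum, h.map_one]
  have hcsum : ∑ g, c g * star (c g) = 1 := by
    rw [← h.expectation_mul_star hu, Unitary.mul_star_self_of_mem u.2, h.map_one]
  refine le_of_eq_of_le (Finset.sum_congr rfl fun i _ => ?_)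
    (hτ.sum_traceEta_sub_le ha hasum hcsum (fun g => α g⁻¹) fun g => hinv g⁻¹)
  have hsa : IsSelfAdjoint (E (x i)) := by
    obtain ⟨z, hz⟩ := ha i
    rw [hz]
    exact .star_mul_self z
  have hsb : IsSelfAdjoint (∑ g, α g⁻¹ (star (c g) * E (x i) * c g)) :=
    isSelfAdjoint_sum _ fun g _ => by
      refine IsSelfAdjoint.map ?_ (α g⁻¹)
      rw [mul_assoc]
      simpa only [mul_assoc, star_star] using hsa.conjugate' (c g)
  rw [h.condExpectation_range hτ hinv, h.condExpectation_conj_range hτ hinv,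
    h.expectation_star_mul_mul hu]
  congr 1
  · refine IsFaithfulTracialState.traceEta_map
      ((Unitary.conjStarAlgAut ℂ M u : M →⋆ₐ[ℂ] M).comp π) (fun y => ?_) hsb
    change (τ ∘ₗ E) (Unitary.conjStarAlgAut ℂ M u (π y)) = τ y
    rw [Unitary.conjStarAlgAut_apply, hσ.trace, ← mul_assoc,
      Unitary.star_mul_self_of_mem u.2, one_mul,
      LinearMap.comp_apply, h.map_embedding]
  · exact IsFaithfulTracialState.traceEta_map π (fun y => by
      rw [LinearMap.comp_apply, h.map_embedding]) hsa

omit hτ hinv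

/-- The crossed product of a factor by an outer action is a factor. -/
theorem central_eq_smul_one (hfactor : ∀ z : A, (∀ x, z * x = x * z) → ∃ c : ℂ, z = c • (1 : A))
    (houter : ∀ g, g ≠ 1 → ∀ a : A, (∀ x, α g x * a = a * x) → a = 0) {z : M}
    (hz : ∀ x, z * x = x * z) : ∃ c : ℂ, z = c • (1 : M) := by
  have hcoeff : ∀ g x, x * E (z * (v g⁻¹ : M)) = E (z * (v g⁻¹ : M)) * α g x := by
    intro g x
    rw [← h.embedding_mul, ← h.mul_embedding, ← mul_assoc, ← hz, mul_assoc, mul_assoc,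
      h.unitary_mul g⁻¹, ← StarAlgEquiv.mul_apply, ← map_mul α, inv_mul_cancel, _root_.map_one]
    rfl
  have h0 : ∀ g, g ≠ 1 → E (z * (v g⁻¹ : M)) = 0 := by
    intro g hg
    refine star_eq_zero.1 (houter g hg _ fun x => ?_)
    have := congrArg star (hcoeff g (star x))
    rw [star_mul, star_mul, star_star, map_star, star_star] at this
    exact this.symm
  obtain ⟨c, hc⟩ := hfactor (E (z * (v 1⁻¹ : M))) fun x => by
    rw [hcoeff 1 x, _root_.map_one]; rfl
  refine ⟨c, ?_⟩
  classical
  rw [h.expansion z, Finset.sum_eq_single (1 : G)]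
  · rw [hc, map_smul, _root_.map_one, _root_.map_one, smul_mul_assoc, one_mul]
    rfl
  · intro g _ hg
    rw [h0 g hg, map_zero, zero_mul]
  · simp

theorem eq_smul_of_conjStarAlgAut_eq
    (hfactor : ∀ z : A, (∀ x, z * x = x * z) → ∃ c : ℂ, z = c • (1 : A))
    (houter : ∀ g, g ≠ 1 → ∀ a : A, (∀ x, α g x * a = a * x) → a = 0) {u w : unitary M}
    (huw : Unitary.conjStarAlgAut ℂ M u = Unitary.conjStarAlgAut ℂ M w) :
    ∃ c : ℂ, (w : M) = c • (u : M) := by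
  obtain ⟨c, hc⟩ := h.central_eq_smul_one hfactor houter (z := star (u : M) * w) fun x => by
    have h1 := congrArg (fun f => star (u : M) * f x * w) huw
    simp only [Unitary.conjStarAlgAut_apply] at h1
    have e1 : star (u : M) * (u * x * star (u : M)) * w = x * (star (u : M) * w) := by
      simp only [← mul_assoc]
      rw [Unitary.star_mul_self_of_mem u.2, one_mul]
    have e2 : star (u : M) * (w * x * star (w : M)) * w = star (u : M) * w * x := by
      simp only [mul_assoc]
      rw [Unitary.star_mul_self_of_mem w.2, mul_one]
    rw [e1, e2] at h1
    exact h1.symm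
  refine ⟨c, ?_⟩
  have := congrArg ((u : M) * ·) hc
  simpa only [← mul_assoc, Unitary.mul_star_self_of_mem u.2, one_mul, mul_smul_comm,
    mul_one] using this

include hτ hinv

/-- The entropy of `Ad u` may be computed from any unitary `w` with `Ad w = Ad u`, since `w` is a
scalar multiple of `u`. -/
theorem sum_negMulLog_condExpectation
    (hfactor : ∀ z : A, (∀ x, z * x = x * z) → ∃ c : ℂ, z = c • (1 : A))
    (houter : ∀ g, g ≠ 1 → ∀ a : A, (∀ x, α g x * a = a * x) → a = 0) {u w : unitary M}
    (huw : Unitary.conjStarAlgAut ℂ M u = Unitary.conjStarAlgAut ℂ M w) {c : G → A}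
    (hu : (u : M) = ∑ g, π (c g) * (v g : M)) :
    ∑ g, Real.negMulLog ((τ ∘ₗ E) (condExpectation (τ ∘ₗ E) π.range ((w : M) * star (v g : M)) *
      star (condExpectation (τ ∘ₗ E) π.range ((w : M) * star (v g : M))))).re =
      ∑ g, Real.negMulLog (τ (c g * star (c g))).re := by
  obtain ⟨l, hl⟩ := h.eq_smul_of_conjStarAlgAut_eq hfactor houter huw
  have hll : l * star l = 1 := by
    have h1 := congrArg (τ ∘ₗ E) (Unitary.mul_star_self_of_mem w.2)
    rw [hl, star_smul, smul_mul_smul_comm, Unitary.mul_star_self_of_mem u.2, map_smul,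
      (h.isFaithfulTracialState_comp hτ hinv).map_one, smul_eq_mul, mul_one] at h1
    exact h1
  refine Finset.sum_congr rfl fun g _ => ?_
  rw [h.condExpectation_range hτ hinv, ← map_star π, ← map_mul π, LinearMap.comp_apply,
    h.map_embedding, ← coe_inv, hl, smul_mul_assoc, map_smul, h.coeff_eq hu, star_smul,
    smul_mul_smul_comm, hll, one_smul]

end IsCrossedSystem

namespace VonNeumannAlgebra

variable {H : Type*} [NormedAddCommGroup H] [InnerProductSpace ℂ H] [CompleteSpace H]
  {G : Type*} [Group G] [Fintype G] {N : VonNeumannAlgebra H}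
  {α : G →* (N.Elem ≃⋆ₐ[ℂ] N.Elem)}

theorem isCrossedSystem {τ : N.Elem →ₗ[ℂ] ℂ} (hτ : N.IsFaithfulNormalTracialState τ)
    (hinv : ∀ g x, τ (α g x) = τ x) :
    IsCrossedSystem α (crossedEmbedding N α) (crossedUnitary N α) (crossedExpectation N α) where
  unitary_mul := crossedUnitary_mul_embedding N α
  expectation_star := crossedExpectation_star N α
  embedding_mul := crossedExpectation_embedding_mul N α
  map_unitary_one := by classical exact (crossedExpectation_unitary N α 1).trans (if_pos rfl)
  map_unitary g hg := by classical exact (crossedExpectation_unitary N α g).trans (if_neg hg)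
  conj := crossedExpectation_conj hτ hinv
  expansion := eq_sum_crossedExpectation hτ hinv

end VonNeumannAlgebra

theorem theorem3p1p4
    {H : Type*} [NormedAddCommGroup H] [InnerProductSpace ℂ H] [CompleteSpace H]
    {G : Type*} [Group G] [Fintype G]
    (N : VonNeumannAlgebra H) (hN : N.IsII1Factor)
    (τ : N.Elem →ₗ[ℂ] ℂ) (hτ : N.IsFaithfulNormalTracialState τ)
    (α : G →* (N.Elem ≃⋆ₐ[ℂ] N.Elem)) (hα : N.IsOuterAction α)
    (u : unitary (N.crossedProduct α).Elem) :
    (∃! c : G → N.Elem, (u : (N.crossedProduct α).Elem) =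
      ∑ g, N.crossedEmbedding α (c g) * (N.crossedUnitary α g : (N.crossedProduct α).Elem)) ∧
    ∀ c : G → N.Elem, (u : (N.crossedProduct α).Elem) =
        ∑ g, N.crossedEmbedding α (c g) * (N.crossedUnitary α g : (N.crossedProduct α).Elem) →
      condRelEntropy (N.crossedTrace α τ) (N.crossedSubalgebra α)
          ((N.crossedSubalgebra α).map
            (Unitary.conjStarAlgAut ℂ (N.crossedProduct α).Elem u : _ →⋆ₐ[ℂ] _)) ≤
        (N.innerAutEntropy α τ (Unitary.conjStarAlgAut ℂ (N.crossedProduct α).Elem u) : EReal) ∧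
      N.innerAutEntropy α τ (Unitary.conjStarAlgAut ℂ (N.crossedProduct α).Elem u) =
        ∑ g, Real.negMulLog (τ (c g * star (c g))).re ∧
      ∑ g, Real.negMulLog (τ (c g * star (c g))).re ≤ Real.log (Fintype.card G) := by
  have hτ' := hτ.isFaithfulTracialState
  have hinv : ∀ g x, τ (α g x) = τ x := fun g x =>
    hτ'.map_automorphism hτ.hasWeakUltralimits hN.factor (α g) x
  have h := VonNeumannAlgebra.isCrossedSystem (α := α) hτ hinv
  refine ⟨⟨_, h.expansion u, fun c hc => funext fun g => (h.coeff_eq hc g).symm⟩, fun c hc => ?_⟩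
  have hent : N.innerAutEntropy α τ (Unitary.conjStarAlgAut ℂ (N.crossedProduct α).Elem u) =
      ∑ g, Real.negMulLog (τ (c g * star (c g))).re := by
    have hex : ∃ w : unitary (N.crossedProduct α).Elem,
        Unitary.conjStarAlgAut ℂ (N.crossedProduct α).Elem u =
          Unitary.conjStarAlgAut ℂ (N.crossedProduct α).Elem w := ⟨u, rfl⟩
    rw [VonNeumannAlgebra.innerAutEntropy, dif_pos hex]
    exact h.sum_negMulLog_condExpectation hτ' hinv hN.factor hα hex.choose_spec hc
  refine ⟨?_, hent, h.sum_negMulLog_le hτ' hc⟩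
  rw [hent]
  exact h.condRelEntropy_le hτ' hinv hc
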